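/- Let $a>0$ and let $q:\mathbb R\to\mathbb R$ be $a$-periodic with $q\in L^1[0,a]$. For integers $n\ge 0$ put $$c_n=\frac1a\int_0^a q(x)e^{-2\pi i n x/a}\,dx,\qquad \rho_n=\sup_{0\le x\le a}\left|\int_0^x q(t)e^{-2\pi i n t/a}\,dt\right|,$$ and suppose that $c_0=0$. Let $\lambda_0\le\lambda_1\le\lambda_2\le\cdots$ be the periodic eigenvalues of $y''+(\lambda-q)y=0$ on $[0,a]$ (boundary conditions $y(a)=y(0)$, $y'(a)=y'(0)$) and $\mu_0\le\mu_1\le\mu_2\le\cdots$ the antiperiodic ones ($y(a)=-y(0)$, $y'(a)=-y'(0)$), each listed with multiplicity. Let $$\ell_{2m+2}=\lambda_{2m+2}-\lambda_{2m+1},\qquad \ell_{2m+1}=\mu_{2m+1}-\mu_{2m}$$ be the widths of the instability intervals $(\lambda_{2m+1},\lambda_{2m+2})$ and $(\mu_{2m},\mu_{2m+1})$. Then the following hold as $m\to\infty$, with $n=n(m)=2m+2$ (periodic case), and likewise with $n=n(m)=2m+1$ (antiperiodic case); the constants in the $O$-terms may depend on $a$ and $q$. 1. If $c_n\ne0$ for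 all large $m$ and $\displaystyle\lim_{m\to\infty}\frac{\rho_n}{m\,c_n}=0$, then $\ell_n=2|c_n|\,(1+o(1))$. 2. If $c_n\sim\rho_n$, i.e. there are constants $0<C_1<C_2$ with $C_1<|c_n/\rho_n|<C_2$ for all sufficiently large $m$, then $\ell_n=2|c_n|\,(1+O(1/m))$. 3. If for some $\varepsilon>0$ one has $|c_n|>\varepsilon/m$ for all sufficiently large $m$, then $\ell_n=2|c_n|\,(1+O(\rho_n))$. -/

import Mathlib

open Filter Topology MeasureTheory

noncomputable section

namespace Hill

/-- `y : ℝ → ℂ` is a (Carathéodory) solution of Hill's equation `y'' + (lam - q) y = 0` on `ℝ`: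
`y` is differentiable, `y'` is locally absolutely continuous, and the equation holds
almost everywhere. -/
def IsSolution (q : ℝ → ℝ) (lam : ℝ) (y : ℝ → ℂ) : Prop :=
  Differentiable ℝ y ∧
    (∀ s t : ℝ, AbsolutelyContinuousOnInterval (deriv y) s t) ∧
    ∀ᵐ x : ℝ, HasDerivAt (deriv y) (((q x - lam : ℝ) : ℂ) * y x) x

/-- The space of solutions of `y'' + (lam - q) y = 0` with `y a = σ y 0` and `y' a = σ y' 0`.
For `σ = 1` these are the periodic and for `σ = -1` the antiperiodic boundary conditions.
The number `lam` is an eigenvalue iff this space is nonzero, and the (complex) dimension of the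
space is its multiplicity. -/
def eigenspace (a : ℝ) (q : ℝ → ℝ) (σ : ℂ) (lam : ℝ) : Submodule ℂ (ℝ → ℂ) where
  carrier := {y | IsSolution q lam y ∧ y a = σ * y 0 ∧ deriv y a = σ * deriv y 0}
  zero_mem' := by
    have h0 : deriv (0 : ℝ → ℂ) = fun _ => (0 : ℂ) := by
      funext x
      exact deriv_const x (0 : ℂ)
    refine ⟨⟨differentiable_const 0, fun s t => ?_, ?_⟩, by simp, by simp [h0]⟩
    · rw [h0]
      exact (contDiff_const (n := 1)).contDiffOn.absolutelyContinuousOnInterval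
    · refine Eventually.of_forall fun x => ?_
      rw [h0]
      simpa using hasDerivAt_const x (0 : ℂ)
  add_mem' := by
    rintro y z ⟨⟨hy1, hy2, hy3⟩, hy4, hy5⟩ ⟨⟨hz1, hz2, hz3⟩, hz4, hz5⟩
    have hd : deriv (y + z) = deriv y + deriv z := by
      funext x
      exact deriv_add (hy1 x) (hz1 x)
    refine ⟨⟨hy1.add hz1, fun s t => ?_, ?_⟩, ?_, ?_⟩
    · rw [hd]
      exact (hy2 s t).add (hz2 s t)
    · filter_upwards [hy3, hz3] with x h1 h2
      rw [hd]
      have h := h1.add h2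
      rwa [← mul_add] at h
    · simp only [Pi.add_apply, hy4, hz4, mul_add]
    · simp only [hd, Pi.add_apply, hy5, hz5, mul_add]
  smul_mem' := by
    rintro c y ⟨⟨hy1, hy2, hy3⟩, hy4, hy5⟩
    have hd : deriv (c • y) = fun x => c • deriv y x := by
      funext x
      exact deriv_const_smul c (hy1 x)
    refine ⟨⟨hy1.const_smul c, fun s t => ?_, ?_⟩, ?_, ?_⟩
    · rw [hd]
      exact (hy2 s t).const_smul c
    · filter_upwards [hy3] with x h1
      rw [hd]
      have h := h1.const_smul c
      have e : c • (((q x - lam : ℝ) : ℂ) * y x) = ((q x - lam : ℝ) : ℂ) * (c • y) x := by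
        simp only [Pi.smul_apply, smul_eq_mul]
        ring
      rwa [e] at h
    · simp only [Pi.smul_apply, smul_eq_mul, hy4]
      ring
    · simp only [hd, smul_eq_mul, hy5]
      ring

/-- The `k`-th eigenvalue, `k = 0, 1, 2, …`, when the eigenvalues are listed in nondecreasing
order and repeated according to multiplicity: the least `t` such that the eigenvalues
`≤ t`, counted with multiplicity, number at least `k + 1`. -/
def eigenvalue (a : ℝ) (q : ℝ → ℝ) (σ : ℂ) (k : ℕ) : ℝ :=
  sInf {t : ℝ | ∃ F : Finset ℝ, (∀ lam ∈ F, lam ≤ t) ∧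
    k + 1 ≤ ∑ lam ∈ F, Module.finrank ℂ (eigenspace a q σ lam)}

/-- The periodic eigenvalues `λ₀ ≤ λ₁ ≤ λ₂ ≤ …`. -/
def periodicEigenvalue (a : ℝ) (q : ℝ → ℝ) (k : ℕ) : ℝ := eigenvalue a q 1 k

/-- The antiperiodic eigenvalues `μ₀ ≤ μ₁ ≤ μ₂ ≤ …`. -/
def antiperiodicEigenvalue (a : ℝ) (q : ℝ → ℝ) (k : ℕ) : ℝ := eigenvalue a q (-1) k

/-- The width `ℓ_{2m+2}` of the instability interval `(λ_{2m+1}, λ_{2m+2})`. -/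
def evenWidth (a : ℝ) (q : ℝ → ℝ) (m : ℕ) : ℝ :=
  periodicEigenvalue a q (2 * m + 2) - periodicEigenvalue a q (2 * m + 1)

/-- The width `ℓ_{2m+1}` of the instability interval `(μ_{2m}, μ_{2m+1})`. -/
def oddWidth (a : ℝ) (q : ℝ → ℝ) (m : ℕ) : ℝ :=
  antiperiodicEigenvalue a q (2 * m + 1) - antiperiodicEigenvalue a q (2 * m)

/-- The function `x ↦ q(x) e^{-i 2 n π x / a}`. -/
def twist (a : ℝ) (q : ℝ → ℝ) (n : ℕ) (x : ℝ) : ℂ :=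
  (q x : ℂ) * Complex.exp (-(Complex.I * (2 * n * Real.pi * x / a : ℝ)))

/-- The Fourier coefficient `c_n = a⁻¹ ∫₀ᵃ q(x) e^{-i 2 n π x / a} dx`. -/
def coeff (a : ℝ) (q : ℝ → ℝ) (n : ℕ) : ℂ :=
  (1 / a : ℂ) * ∫ x in (0 : ℝ)..a, twist a q n x

/-- `sup_{0 ≤ x ≤ a} |∫₀ˣ q(t) e^{∓ i 2 n π t / a} dt|`. Since `q` is real, both signs give the
same value. -/
def rho (a : ℝ) (q : ℝ → ℝ) (n : ℕ) : ℝ :=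
  ⨆ x : Set.Icc (0 : ℝ) a, ‖∫ t in (0 : ℝ)..x, twist a q n t‖

/-- The condition `lim_{m → ∞} r m / (m c_m) = 0`; it includes that the quotient is defined for
all large `m`. -/
def LimCondition (c : ℕ → ℂ) (r : ℕ → ℝ) : Prop :=
  (∀ᶠ m : ℕ in atTop, c m ≠ 0) ∧
    Tendsto (fun m : ℕ => (r m : ℂ) / ((m : ℂ) * c m)) atTop (𝓝 0)

/-- The condition `c_m ∼ r m`: there are constants `0 < C₁ < C₂` with
`C₁ < |c_m / r m| < C₂` for all sufficiently large `m`. -/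
def SimCondition (c : ℕ → ℂ) (r : ℕ → ℝ) : Prop :=
  ∃ C₁ C₂ : ℝ, 0 < C₁ ∧ C₁ < C₂ ∧
    ∀ᶠ m : ℕ in atTop, C₁ < ‖c m / (r m : ℂ)‖ ∧ ‖c m / (r m : ℂ)‖ < C₂

/-- The condition `|c_m| > ε / m` for all sufficiently large `m`, with some `ε > 0`. -/
def LowerCondition (c : ℕ → ℂ) : Prop :=
  ∃ ε : ℝ, 0 < ε ∧ ∀ᶠ m : ℕ in atTop, ε / m < ‖c m‖

end Hill

end

/-!
The width of the `n`-th instability interval satisfies `|ℓ_n - 2 |c_n|| ≤ C ρ_n / n` for large `n`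
(`Hill.exists_width_bound`). The three statements are this bound divided by `2 |c_n|`
(`Hill.width_asymptotics`). The bound comes from counting rotations of the Prüfer angle.

Let `Q` be the primitive of `q` with `Q 0 = 0`. As `c_0 = 0`, it is periodic, hence bounded. With
the quasi-derivative `z = y' - Q y` Hill's equation becomes the system `y' = Q y + z`,
`z' = -(lam + Q²) y - Q z`, whose coefficients are continuous. In polar coordinates `y = r sin θ`,
`z = N r cos θ` the angle solves a scalar equation with bounded, Lipschitz right-hand side, is
increasing in `lam`, and determines `r`. As `Q` vanishes at `0` and `a`, the boundary conditions
may be read off from `(y, z)`.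

Let `rot lam x` be the increase of `θ` over one period from the initial angle `x`, with maximum
`U lam` and minimum `L lam` over `x`. The monodromy matrix `M` has determinant `1`, and where
`rot lam` is a multiple of `π` the quadratic form `det (v, M v)` vanishes. It is semidefinite
exactly when such an angle is extremal, and then the eigenvalue of `M` is `±1`. So the multiplicity
of `lam` as a periodic or antiperiodic eigenvalue is the number of `U lam`, `L lam` that are even,
respectively odd, multiples of `π` (`Hill.IsHillData.finrank_eigenspace`). Both functions are
continuous and strictly increasing, `U > 0`, `L > -π` and `U < L + π`, and counting shows that
`U = n π` at the lower and `L = n π` at the upper edge of the `n`-th interval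
(`Hill.IsRotationPair.isLeast_max`, `Hill.IsRotationPair.isLeast_min`).

To locate these parameters take `N = n π / a`. The classical Prüfer angle `T`, which agrees with
`θ` at `0` and `a`, satisfies `T' = N + N⁻¹ (lam - N² - q) sin² T` almost everywhere. Put
`κ = lam - N²`. Integration over a period, followed by an integration by parts against the partial
Fourier integrals of `q`, which are bounded by `ρ_n`, gives
`2 N (rot lam x - n π) = κ a + a |c_n| cos (2 θ(a) + β) + O((ρ_n + |κ| / N) (1 + |κ|) / N)`
(`Hill.IsHillData.abs_rotation_sub_le`). The final angle `θ(a)` takes every value, so the maximum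
over `x` vanishes at `κ = -|c_n| + O(ρ_n / n)` and the minimum at `κ = |c_n| + O(ρ_n / n)`
(`Hill.IsHillData.exists_edges`).
-/

noncomputable section

namespace Hill

open scoped NNReal

section

/-! ### Scalar differential equations with a bounded Lipschitz right-hand side -/

/-- A time-dependent vector field on `ℝ` that is continuous in time, bounded and uniformly
Lipschitz has integral curves defined for all times: since the field is bounded, the
Picard–Lindelöf theorem applies on every interval `[-(k+1), k+1]`, and the curves obtained agree
by uniqueness. -/
theorem exists_global_integralCurve {f : ℝ → ℝ → ℝ} {K L : ℝ≥0}
    (hc : ∀ x, Continuous fun t => f t x) (hK : ∀ t, LipschitzWith K (f t))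
    (hL : ∀ t x, ‖f t x‖ ≤ L) (x₀ : ℝ) :
    ∃ α : ℝ → ℝ, α 0 = x₀ ∧ ∀ t, HasDerivAt α (f t (α t)) t := by
  have key : ∀ k : ℕ, ∃ α : ℝ → ℝ, α 0 = x₀ ∧
      ∀ t ∈ Set.Ioo (-((k : ℝ) + 1)) (k + 1), HasDerivAt α (f t (α t)) t := by
    intro k
    have hk : (0 : ℝ) ∈ Set.Icc (-((k : ℝ) + 1)) (k + 1) := by
      constructor <;> nlinarith [(Nat.cast_nonneg k : (0 : ℝ) ≤ k)]
    have hPL : IsPicardLindelof f (⟨0, hk⟩ : Set.Icc (-((k : ℝ) + 1)) (k + 1)) x₀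
        (L * (k + 1)) 0 L K :=
      { lipschitzOnWith := fun t _ => (hK t).lipschitzOnWith
        continuousOn := fun x _ => (hc x).continuousOn
        norm_le := fun t _ x _ => hL t x
        mul_max_le := by simp }
    obtain ⟨α, h0, hα⟩ := hPL.exists_eq_forall_mem_Icc_hasDerivWithinAt₀
    exact ⟨α, h0, fun t ht => (hα t (Set.Ioo_subset_Icc_self ht)).hasDerivAt
      (Icc_mem_nhds ht.1 ht.2)⟩
  choose α h0 hα using key
  have hagree : ∀ k l : ℕ, k ≤ l → ∀ t ∈ Set.Ioo (-((k : ℝ) + 1)) (k + 1), α k t = α l t := by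
    intro k l hkl
    have hkl' : (k : ℝ) ≤ l := by exact_mod_cast hkl
    have hk0 : (0 : ℝ) ≤ k := Nat.cast_nonneg k
    refine ODE_solution_unique_of_mem_Ioo (v := f) (s := fun _ => Set.univ) (K := K) (t₀ := 0)
      (fun t _ => (hK t).lipschitzOnWith) ⟨by linarith, by linarith⟩
      (fun t ht => ⟨hα k t ht, trivial⟩)
      (fun t ht => ⟨hα l t ⟨by linarith [ht.1], by linarith [ht.2]⟩, trivial⟩) ?_
    rw [h0, h0]
  have habs : ∀ t : ℝ, t ∈ Set.Ioo (-((⌈|t|⌉₊ : ℝ) + 1)) (⌈|t|⌉₊ + 1) := by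
    intro t
    have := Nat.le_ceil |t|
    constructor <;> linarith [neg_abs_le t, le_abs_self t]
  refine ⟨fun t => α ⌈|t|⌉₊ t, by simp [h0], fun t => ?_⟩
  refine (hα _ t (habs t)).congr_of_eventuallyEq ?_
  filter_upwards [Ioo_mem_nhds (habs t).1 (habs t).2] with s hs
  rcases le_total ⌈|t|⌉₊ ⌈|s|⌉₊ with h | h
  · exact (hagree _ _ h s hs).symm
  · exact hagree _ _ h s (habs s)

/-! ### The regularised Prüfer angle -/

/-- The right-hand side of the equation for the regularised Prüfer angle. If `Q' = q`, then
`y'' + (lam - q) y = 0` is the system `y' = Q y + z`, `z' = -(lam + Q²) y - Q z` for the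
quasi-derivative `z = y' - Q y`; in polar coordinates `y = r sin θ`, `z = N r cos θ` the angle
satisfies `θ' = angleField N Q lam t θ`. -/
def angleField (N : ℝ) (Q : ℝ → ℝ) (lam t θ : ℝ) : ℝ :=
  N⁻¹ * ((N * Real.cos θ + Q t * Real.sin θ) ^ 2 + lam * Real.sin θ ^ 2)

open Classical in
/-- The regularised Prüfer angle with value `x` at time `0` (the constant `0` if the equation
for the angle has no global solution). -/
def angle (N : ℝ) (Q : ℝ → ℝ) (lam x : ℝ) : ℝ → ℝ :=
  if h : ∃ α : ℝ → ℝ, α 0 = x ∧ ∀ t, HasDerivAt α (angleField N Q lam t (α t)) t then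
    Classical.choose h
  else 0

/-- A Lipschitz constant, and also a bound, for `angleField` if `|Q| ≤ B`. -/
def angleBound (N B lam : ℝ) : ℝ≥0 := Real.toNNReal (N⁻¹ * (2 * (N + B) ^ 2 + 2 * |lam|))

variable {N B : ℝ} {Q : ℝ → ℝ}

theorem coe_angleBound (hN : 0 < N) (lam : ℝ) :
    (angleBound N B lam : ℝ) = N⁻¹ * (2 * (N + B) ^ 2 + 2 * |lam|) :=
  Real.coe_toNNReal _ (by positivity)

theorem continuous_angleField (hQ : Continuous Q) (lam : ℝ) :
    Continuous fun p : ℝ × ℝ => angleField N Q lam p.1 p.2 := by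
  unfold angleField
  fun_prop

theorem norm_angleField_le (hN : 0 < N) (hB : ∀ t, |Q t| ≤ B) (lam t θ : ℝ) :
    ‖angleField N Q lam t θ‖ ≤ angleBound N B lam := by
  have hB0 : 0 ≤ B := (abs_nonneg _).trans (hB 0)
  rw [coe_angleBound hN, angleField, norm_mul, Real.norm_of_nonneg (inv_nonneg.2 hN.le)]
  gcongr
  have h1 : |N * Real.cos θ + Q t * Real.sin θ| ≤ N + B := by
    refine (abs_add_le _ _).trans ?_
    rw [abs_mul, abs_mul, abs_of_pos hN]
    have := Real.abs_cos_le_one θ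
    have := Real.abs_sin_le_one θ
    have := mul_le_mul (hB t) this (abs_nonneg _) hB0
    nlinarith
  have h2 : (N * Real.cos θ + Q t * Real.sin θ) ^ 2 ≤ (N + B) ^ 2 := sq_le_sq' (abs_le.1 h1).1
    (abs_le.1 h1).2
  have h3 : |lam * Real.sin θ ^ 2| ≤ |lam| := by
    rw [abs_mul, abs_of_nonneg (sq_nonneg (Real.sin θ))]
    exact mul_le_of_le_one_right (abs_nonneg _) (Real.sin_sq_le_one θ)
  rw [Real.norm_eq_abs]
  refine (abs_add_le _ _).trans ?_
  rw [abs_of_nonneg (sq_nonneg (N * Real.cos θ + Q t * Real.sin θ))]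
  nlinarith [abs_nonneg lam]

theorem lipschitzWith_angleField (hN : 0 < N) (hB : ∀ t, |Q t| ≤ B) (lam t : ℝ) :
    LipschitzWith (angleBound N B lam) (angleField N Q lam t) := by
  have hB0 : 0 ≤ B := (abs_nonneg _).trans (hB 0)
  have hd : ∀ θ, HasDerivAt (angleField N Q lam t)
      (N⁻¹ * (2 * (N * Real.cos θ + Q t * Real.sin θ) * (-(N * Real.sin θ) + Q t * Real.cos θ)
        + 2 * lam * (Real.sin θ * Real.cos θ))) θ := by
    intro θ
    have h1 := ((((Real.hasDerivAt_cos θ).const_mul N).add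
      ((Real.hasDerivAt_sin θ).const_mul (Q t))).pow 2).add
      (((Real.hasDerivAt_sin θ).pow 2).const_mul lam)
    refine (h1.const_mul N⁻¹).congr_deriv ?_
    simp only [Pi.add_apply]
    push_cast
    ring
  refine lipschitzWith_of_nnnorm_deriv_le (fun θ => (hd θ).differentiableAt) fun θ => ?_
  rw [← NNReal.coe_le_coe, coe_nnnorm, (hd θ).deriv, coe_angleBound hN, norm_mul,
    Real.norm_of_nonneg (inv_nonneg.2 hN.le)]
  gcongr
  have hs := Real.abs_sin_le_one θ
  have hcs := Real.abs_cos_le_one θ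
  have hQs : |Q t * Real.sin θ| ≤ B := by
    rw [abs_mul]; exact (mul_le_of_le_one_right (abs_nonneg _) hs).trans (hB t)
  have hQc : |Q t * Real.cos θ| ≤ B := by
    rw [abs_mul]; exact (mul_le_of_le_one_right (abs_nonneg _) hcs).trans (hB t)
  have hNs : |N * Real.sin θ| ≤ N := by
    rw [abs_mul, abs_of_pos hN]; exact mul_le_of_le_one_right hN.le hs
  have hNc : |N * Real.cos θ| ≤ N := by
    rw [abs_mul, abs_of_pos hN]; exact mul_le_of_le_one_right hN.le hcs
  have h1 : |N * Real.cos θ + Q t * Real.sin θ| ≤ N + B := (abs_add_le _ _).trans (by linarith)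
  have h2 : |-(N * Real.sin θ) + Q t * Real.cos θ| ≤ N + B :=
    (abs_add_le _ _).trans (by rw [abs_neg]; linarith)
  have h3 : |Real.sin θ * Real.cos θ| ≤ 1 := by
    rw [abs_mul]; exact mul_le_one₀ hs (abs_nonneg _) hcs
  rw [Real.norm_eq_abs]
  refine (abs_add_le _ _).trans ?_
  rw [abs_mul, abs_mul, abs_mul (2 * lam), abs_mul 2 lam, abs_two]
  have h4 := mul_le_mul h1 h2 (abs_nonneg _) (by positivity)
  have h5 := mul_le_mul_of_nonneg_left h3 (abs_nonneg lam)
  nlinarith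

section

variable (hN : 0 < N) (hQ : Continuous Q) (hB : ∀ t, |Q t| ≤ B)
include hN hQ hB

theorem exists_angle (lam x : ℝ) :
    ∃ α : ℝ → ℝ, α 0 = x ∧ ∀ t, HasDerivAt α (angleField N Q lam t (α t)) t :=
  exists_global_integralCurve
    (fun θ => (continuous_angleField hQ lam).comp (by fun_prop : Continuous fun t => (t, θ)))
    (lipschitzWith_angleField hN hB lam) (norm_angleField_le hN hB lam) x

theorem angle_zero (lam x : ℝ) : angle N Q lam x 0 = x := by
  rw [angle, dif_pos (exists_angle hN hQ hB lam x)]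
  exact (Classical.choose_spec (exists_angle hN hQ hB lam x)).1

theorem hasDerivAt_angle (lam x t : ℝ) :
    HasDerivAt (angle N Q lam x) (angleField N Q lam t (angle N Q lam x t)) t := by
  rw [angle, dif_pos (exists_angle hN hQ hB lam x)]
  exact (Classical.choose_spec (exists_angle hN hQ hB lam x)).2 t

theorem continuous_angle (lam x : ℝ) : Continuous (angle N Q lam x) :=
  continuous_iff_continuousAt.2 fun t => (hasDerivAt_angle hN hQ hB lam x t).continuousAt

omit hQ in
theorem angle_unique {lam : ℝ} {α β : ℝ → ℝ}
    (hα : ∀ t, HasDerivAt α (angleField N Q lam t (α t)) t)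
    (hβ : ∀ t, HasDerivAt β (angleField N Q lam t (β t)) t) {t₀ : ℝ} (h : α t₀ = β t₀) :
    α = β :=
  ODE_solution_unique_univ (s := fun _ => Set.univ) (K := angleBound N B lam) (t₀ := t₀)
    (fun t => (lipschitzWith_angleField hN hB lam t).lipschitzOnWith)
    (fun t => ⟨hα t, trivial⟩) (fun t => ⟨hβ t, trivial⟩) h

theorem angle_add_pi (lam x t : ℝ) :
    angle N Q lam (x + Real.pi) t = angle N Q lam x t + Real.pi := by
  refine congrFun (angle_unique hN hB (hasDerivAt_angle hN hQ hB lam (x + Real.pi))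
    (β := fun t => angle N Q lam x t + Real.pi) (fun t => ?_) (t₀ := 0) ?_) t
  · refine ((hasDerivAt_angle hN hQ hB lam x t).add_const _).congr_deriv ?_
    simp only [angleField, Real.cos_add_pi, Real.sin_add_pi]
    ring
  · simp only [angle_zero hN hQ hB]

/-- Two angles for the same `lam` never meet. -/
theorem angle_strictMono_init (lam t : ℝ) : StrictMono fun x => angle N Q lam x t := by
  intro x x' hx
  by_contra! h
  have hc : Continuous fun s => angle N Q lam x' s - angle N Q lam x s :=
    (continuous_angle hN hQ hB lam x').sub (continuous_angle hN hQ hB lam x)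
  have hmem : (0 : ℝ) ∈ Set.uIcc (angle N Q lam x' 0 - angle N Q lam x 0)
      (angle N Q lam x' t - angle N Q lam x t) := by
    rw [angle_zero hN hQ hB, angle_zero hN hQ hB]
    exact Set.mem_uIcc.2 (Or.inr ⟨by linarith [h], by linarith⟩)
  obtain ⟨s, -, hs⟩ := intermediate_value_uIcc hc.continuousOn hmem
  have := angle_unique hN hB (hasDerivAt_angle hN hQ hB lam x')
    (hasDerivAt_angle hN hQ hB lam x) (t₀ := s) (by simpa [sub_eq_zero] using hs)
  have h0 := congrFun this 0
  rw [angle_zero hN hQ hB, angle_zero hN hQ hB] at h0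
  exact hx.ne' h0

theorem angle_mono_param {lam lam' : ℝ} (h : lam ≤ lam') (x : ℝ) {t : ℝ} (ht : 0 ≤ t) :
    angle N Q lam x t ≤ angle N Q lam' x t := by
  set K : ℝ := ((angleBound N B lam : ℝ≥0) : ℝ)
  have hK0 : 0 ≤ K := NNReal.coe_nonneg _
  -- `u ≤ v + ε e^{(K+1)s}`: where equality holds, the right-hand side grows strictly faster
  have key : ∀ ε > 0, angle N Q lam x t ≤
      angle N Q lam' x t + ε * Real.exp ((K + 1) * t) := by
    intro ε hε
    have hb : ∀ s, HasDerivAt (fun s => angle N Q lam' x s + ε * Real.exp ((K + 1) * s))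
        (angleField N Q lam' s (angle N Q lam' x s) + ε * (Real.exp ((K + 1) * s) * (K + 1))) s :=
      fun s => (hasDerivAt_angle hN hQ hB lam' x s).add
        ((((hasDerivAt_id s).const_mul (K + 1)).exp.const_mul ε).congr_deriv (by simp))
    refine image_le_of_deriv_right_lt_deriv_boundary
      (continuous_angle hN hQ hB lam x).continuousOn
      (fun s _ => (hasDerivAt_angle hN hQ hB lam x s).hasDerivWithinAt)
      ?_ hb (fun s _ heq => ?_) (Set.right_mem_Icc.2 ht)
    · simp only [angle_zero hN hQ hB]
      simp [hε.le]
    · set u := angle N Q lam x s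
      set v := angle N Q lam' x s
      have hE := Real.exp_pos ((K + 1) * s)
      have h1 : |angleField N Q lam s u - angleField N Q lam s v| ≤ K * |u - v| := by
        have := (lipschitzWith_angleField hN hB lam s).dist_le_mul u v
        rwa [Real.dist_eq, Real.dist_eq] at this
      have h2 : u - v = ε * Real.exp ((K + 1) * s) := by rw [heq]; ring
      rw [h2, abs_of_pos (by positivity : 0 < ε * Real.exp ((K + 1) * s))] at h1
      have h3 : angleField N Q lam s v ≤ angleField N Q lam' s v := by
        unfold angleField
        gcongr
      have h4 := (abs_le.1 h1).2
      have : 0 < ε * Real.exp ((K + 1) * s) := by positivity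
      nlinarith
  by_contra! hlt
  have hE := Real.exp_pos ((K + 1) * t)
  have h1 := key ((angle N Q lam x t - angle N Q lam' x t) / 2 / Real.exp ((K + 1) * t))
    (div_pos (by linarith) hE)
  rw [div_mul_cancel₀ _ hE.ne'] at h1
  linarith

/-- By monotonicity, two angles for different parameters that agree at `t > 0` agree on `[0, t]`;
since the parameter enters the equation through `lam sin²`, the sine of the angle vanishes there. -/
theorem angle_strictMono_param {lam lam' : ℝ} (h : lam < lam') (x : ℝ) {t : ℝ} (ht : 0 < t) :
    angle N Q lam x t < angle N Q lam' x t := by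
  refine lt_of_le_of_ne (angle_mono_param hN hQ hB h.le x ht.le) fun heq => ?_
  set K : ℝ := ((angleBound N B lam : ℝ≥0) : ℝ)
  set u := angle N Q lam x with hu
  set v := angle N Q lam' x with hv
  have huv : ∀ s, 0 ≤ s → u s ≤ v s := fun s hs => angle_mono_param hN hQ hB h.le x hs
  let w : ℝ → ℝ := fun s => Real.exp (K * s) * (v s - u s)
  have hw : ∀ s, HasDerivAt w (Real.exp (K * s) * (K * (v s - u s) +
      (angleField N Q lam' s (v s) - angleField N Q lam s (u s)))) s := by
    intro s
    have h1 : HasDerivAt (fun s => Real.exp (K * s)) (Real.exp (K * s) * K) s :=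
      (((hasDerivAt_id s).const_mul K).exp).congr_deriv (by simp)
    refine (h1.mul ((hasDerivAt_angle hN hQ hB lam' x s).sub
      (hasDerivAt_angle hN hQ hB lam x s))).congr_deriv ?_
    simp only [Pi.sub_apply, ← hu, ← hv]
    ring
  have hlow : ∀ s, 0 ≤ s → N⁻¹ * ((lam' - lam) * Real.sin (v s) ^ 2) ≤ K * (v s - u s) +
      (angleField N Q lam' s (v s) - angleField N Q lam s (u s)) := by
    intro s hs
    have h1 := (lipschitzWith_angleField hN hB lam s).dist_le_mul (v s) (u s)
    rw [Real.dist_eq, Real.dist_eq, abs_of_nonneg (sub_nonneg.2 (huv s hs))] at h1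
    have h2 : angleField N Q lam' s (v s) =
        angleField N Q lam s (v s) + N⁻¹ * ((lam' - lam) * Real.sin (v s) ^ 2) := by
      unfold angleField; ring
    have h3 := (abs_le.1 h1).1
    rw [h2]
    linarith
  have hpos : ∀ s, 0 ≤ N⁻¹ * ((lam' - lam) * Real.sin (v s) ^ 2) := fun s =>
    mul_nonneg (inv_nonneg.2 hN.le) (mul_nonneg (by linarith) (sq_nonneg _))
  have hwc : Continuous w := continuous_iff_continuousAt.2 fun s => (hw s).continuousAt
  have hmono : MonotoneOn w (Set.Icc 0 t) := by
    refine monotoneOn_of_deriv_nonneg (convex_Icc _ _) hwc.continuousOn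
      (fun s _ => (hw s).differentiableAt.differentiableWithinAt) fun s hs => ?_
    rw [interior_Icc] at hs
    rw [(hw s).deriv]
    exact mul_nonneg (Real.exp_pos _).le ((hpos s).trans (hlow s hs.1.le))
  have hw0 : ∀ s ∈ Set.Icc 0 t, w s = 0 := by
    intro s hs
    have h1 : w s ≤ w t := hmono hs (Set.right_mem_Icc.2 ht.le) hs.2
    have h2 : w t = 0 := by simp [w, heq]
    have h3 : 0 ≤ w s := mul_nonneg (Real.exp_pos _).le (sub_nonneg.2 (huv s hs.1))
    linarith
  have hsin : ∀ s ∈ Set.Ioo 0 t, Real.sin (v s) = 0 := by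
    intro s hs
    have h1 : HasDerivAt w 0 s := (hasDerivAt_const s (0 : ℝ)).congr_of_eventuallyEq (by
      filter_upwards [Ioo_mem_nhds hs.1 hs.2] with r hr
      exact hw0 r (Set.Ioo_subset_Icc_self hr))
    have h2 := (hw s).unique h1
    have h3 := (mul_eq_zero.1 h2).resolve_left (Real.exp_pos _).ne'
    have h4 := hlow s hs.1.le
    rw [h3] at h4
    have h5 := le_antisymm h4 (hpos s)
    have h6 := (mul_eq_zero.1 h5).resolve_left (inv_pos.2 hN).ne'
    exact pow_eq_zero_iff two_ne_zero |>.1 ((mul_eq_zero.1 h6).resolve_left (by linarith))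
  -- the angle cannot stay at a multiple of `π`, where its derivative is `N`
  have hmid : t / 2 ∈ Set.Ioo 0 t := ⟨by linarith, by linarith⟩
  have h1 : HasDerivAt (fun s => Real.sin (v s)) 0 (t / 2) :=
    (hasDerivAt_const (t / 2) (0 : ℝ)).congr_of_eventuallyEq (by
      filter_upwards [Ioo_mem_nhds hmid.1 hmid.2] with r hr using hsin r hr)
  have h2 := (hasDerivAt_angle hN hQ hB lam' x (t / 2)).sin.unique h1
  have h3 := hsin _ hmid
  have h4 := Real.sin_sq_add_cos_sq (v (t / 2))
  rw [← hv, angleField, h3] at h2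
  rw [h3] at h4
  have h5 : Real.cos (v (t / 2)) ≠ 0 := by
    intro h; rw [h] at h4; norm_num at h4
  simp [h5, hN.ne'] at h2

/-- An angle starting at `0` is positive afterwards: at multiples of `π` it increases. -/
theorem angle_pos (lam : ℝ) {t : ℝ} (ht : 0 < t) : 0 < angle N Q lam 0 t := by
  refine lt_of_le_of_lt ?_ (angle_strictMono_param hN hQ hB (sub_one_lt lam) 0 ht)
  refine neg_nonpos.1 (image_le_of_deriv_right_lt_deriv_boundary
    (f := fun s => -angle N Q (lam - 1) 0 s) (B := fun _ => 0) (B' := fun _ => 0)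
    (continuous_angle hN hQ hB (lam - 1) 0).neg.continuousOn
    (fun s _ => (hasDerivAt_angle hN hQ hB (lam - 1) 0 s).neg.hasDerivWithinAt)
    (by simp [angle_zero hN hQ hB]) (fun s => hasDerivAt_const s 0) (fun s _ hs => ?_)
    (Set.right_mem_Icc.2 ht.le))
  rw [neg_eq_zero.1 hs]
  simp only [angleField, Real.cos_zero, Real.sin_zero]
  have : 0 < N⁻¹ * N ^ 2 := by positivity
  simpa using this

/-- For very negative `lam` the angle cannot cross `π / 2` upwards. -/
theorem angle_pi_div_two_lt {lam : ℝ} (hlam : lam ≤ -(B ^ 2) - 2) {t : ℝ} (ht : 0 < t) :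
    angle N Q lam (Real.pi / 2) t < Real.pi / 2 := by
  refine lt_of_lt_of_le (angle_strictMono_param hN hQ hB (lt_add_one lam) (Real.pi / 2) ht) ?_
  refine image_le_of_deriv_right_lt_deriv_boundary
    (f := angle N Q (lam + 1) (Real.pi / 2)) (B := fun _ => Real.pi / 2) (B' := fun _ => 0)
    (continuous_angle hN hQ hB (lam + 1) _).continuousOn
    (fun s _ => (hasDerivAt_angle hN hQ hB (lam + 1) _ s).hasDerivWithinAt)
    (by simp [angle_zero hN hQ hB]) (fun s => hasDerivAt_const s _) (fun s _ hs => ?_)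
    (Set.right_mem_Icc.2 ht.le)
  rw [hs]
  simp only [angleField, Real.cos_pi_div_two, Real.sin_pi_div_two]
  have h1 : Q s ^ 2 ≤ B ^ 2 := sq_le_sq' (abs_le.1 (hB s)).1 (abs_le.1 (hB s)).2
  have : N⁻¹ * (Q s ^ 2 + (lam + 1)) < 0 := mul_neg_of_pos_of_neg (inv_pos.2 hN) (by linarith)
  simpa using this

/-- Joint continuity in the parameter and the initial value, by Grönwall's inequality. -/
theorem continuous_angle_param {t : ℝ} (ht : 0 ≤ t) :
    Continuous fun p : ℝ × ℝ => angle N Q p.1 p.2 t := by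
  refine continuous_iff_continuousAt.2 fun p => ?_
  set K := angleBound N B p.1
  have hbound : ∀ r : ℝ × ℝ, dist (angle N Q r.1 r.2 t) (angle N Q p.1 p.2 t) ≤
      |r.2 - p.2| * Real.exp (((K : ℝ) + 1) * t) +
        N⁻¹ * |r.1 - p.1| / (K + 1) * (Real.exp (((K : ℝ) + 1) * t) - 1) := by
    intro r
    have h := dist_le_of_approx_trajectories_ODE (v := angleField N Q p.1) (K := K + 1)
      (a := 0) (b := t) (f := angle N Q r.1 r.2) (g := angle N Q p.1 p.2)
      (f' := fun s => angleField N Q r.1 s (angle N Q r.1 r.2 s))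
      (g' := fun s => angleField N Q p.1 s (angle N Q p.1 p.2 s))
      (εf := N⁻¹ * |r.1 - p.1|) (εg := 0) (δ := |r.2 - p.2|)
      (fun s => (lipschitzWith_angleField hN hB p.1 s).weaken (by simp [K]))
      (continuous_angle hN hQ hB _ _).continuousOn
      (fun s _ => (hasDerivAt_angle hN hQ hB _ _ s).hasDerivWithinAt)
      (fun s _ => ?_)
      (continuous_angle hN hQ hB _ _).continuousOn
      (fun s _ => (hasDerivAt_angle hN hQ hB _ _ s).hasDerivWithinAt)
      (fun s _ => by rw [dist_self])
      (by rw [angle_zero hN hQ hB, angle_zero hN hQ hB, Real.dist_eq]) t (Set.right_mem_Icc.2 ht)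
    · rw [gronwallBound_of_K_ne_0 (by positivity)] at h
      simpa using h
    · set θ := angle N Q r.1 r.2 s
      have : angleField N Q r.1 s θ - angleField N Q p.1 s θ =
          N⁻¹ * ((r.1 - p.1) * Real.sin θ ^ 2) := by unfold angleField; ring
      rw [Real.dist_eq, this, abs_mul, abs_mul, abs_of_pos (inv_pos.2 hN),
        abs_of_nonneg (sq_nonneg (Real.sin θ))]
      gcongr
      exact mul_le_of_le_one_right (abs_nonneg _) (Real.sin_sq_le_one θ)
  refine tendsto_iff_dist_tendsto_zero.2 (squeeze_zero (fun _ => dist_nonneg) hbound ?_)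
  have hc : Continuous fun r : ℝ × ℝ => |r.2 - p.2| * Real.exp (((K : ℝ) + 1) * t) +
        N⁻¹ * |r.1 - p.1| / (K + 1) * (Real.exp (((K : ℝ) + 1) * t) - 1) := by fun_prop
  simpa using hc.tendsto p

end

end

section

/-! ### The regularised first-order system -/

/-- `y` together with its quasi-derivative `z = y' - Q y` satisfies the first-order system
equivalent to `y'' + (lam - Q') y = 0`. Its coefficients are continuous although `Q'` is merely
integrable. -/
def IsQuasiSolution (Q : ℝ → ℝ) (lam : ℝ) (y z : ℝ → ℂ) : Prop :=
  (∀ t, HasDerivAt y (Q t * y t + z t) t) ∧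
    ∀ t, HasDerivAt z (-(lam + (Q t : ℂ) ^ 2) * y t - Q t * z t) t

theorem IsQuasiSolution.add {Q : ℝ → ℝ} {lam : ℝ} {y z u v : ℝ → ℂ}
    (h : IsQuasiSolution Q lam y z) (h' : IsQuasiSolution Q lam u v) :
    IsQuasiSolution Q lam (fun t => y t + u t) (fun t => z t + v t) :=
  ⟨fun t => ((h.1 t).add (h'.1 t)).congr_deriv (by ring),
    fun t => ((h.2 t).add (h'.2 t)).congr_deriv (by ring)⟩

theorem IsQuasiSolution.const_mul {Q : ℝ → ℝ} {lam : ℝ} {y z : ℝ → ℂ} (c : ℂ)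
    (h : IsQuasiSolution Q lam y z) :
    IsQuasiSolution Q lam (fun t => c * y t) (fun t => c * z t) :=
  ⟨fun t => ((h.1 t).const_mul c).congr_deriv (by ring),
    fun t => ((h.2 t).const_mul c).congr_deriv (by ring)⟩

theorem IsQuasiSolution.wronskian_eq {Q : ℝ → ℝ} {lam : ℝ} {y z u v : ℝ → ℂ}
    (h : IsQuasiSolution Q lam y z) (h' : IsQuasiSolution Q lam u v) (t : ℝ) :
    y t * v t - z t * u t = y 0 * v 0 - z 0 * u 0 := by
  have hd : ∀ s, HasDerivAt (fun s => y s * v s - z s * u s) 0 s := fun s =>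
    (((h.1 s).mul (h'.2 s)).sub ((h.2 s).mul (h'.1 s))).congr_deriv (by ring)
  exact is_const_of_deriv_eq_zero (fun s => (hd s).differentiableAt) (fun s => (hd s).deriv) t 0

/-- The logarithmic derivative of the Prüfer radius along the Prüfer angle `θ`. -/
def radialRate (N : ℝ) (Q : ℝ → ℝ) (lam t θ : ℝ) : ℝ :=
  (Q t * Real.sin θ + N * Real.cos θ) * Real.sin θ -
    ((lam + Q t ^ 2) * Real.sin θ * N⁻¹ + Q t * Real.cos θ) * Real.cos θ

/-- The Prüfer radius with value `1` at time `0`. -/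
def radius (N : ℝ) (Q : ℝ → ℝ) (lam x t : ℝ) : ℝ :=
  Real.exp (∫ s in (0 : ℝ)..t, radialRate N Q lam s (angle N Q lam x s))

/-- The solution with Prüfer angle `x` and Prüfer radius `1` at time `0`. -/
def polarSol (N : ℝ) (Q : ℝ → ℝ) (lam x t : ℝ) : ℝ :=
  radius N Q lam x t * Real.sin (angle N Q lam x t)

/-- The quasi-derivative of `polarSol`. -/
def polarQuasi (N : ℝ) (Q : ℝ → ℝ) (lam x t : ℝ) : ℝ :=
  N * (radius N Q lam x t * Real.cos (angle N Q lam x t))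

variable {N B : ℝ} {Q : ℝ → ℝ}

theorem radius_pos (lam x t : ℝ) : 0 < radius N Q lam x t := Real.exp_pos _

theorem radius_zero (lam x : ℝ) : radius N Q lam x 0 = 1 := by simp [radius]

section

variable (hN : 0 < N) (hQ : Continuous Q) (hB : ∀ t, |Q t| ≤ B)
include hN hQ hB

theorem hasDerivAt_radius (lam x t : ℝ) :
    HasDerivAt (radius N Q lam x)
      (radius N Q lam x t * radialRate N Q lam t (angle N Q lam x t)) t := by
  have hc : Continuous fun s => radialRate N Q lam s (angle N Q lam x s) := by
    have := continuous_angle hN hQ hB lam x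
    unfold radialRate
    fun_prop
  exact (hc.integral_hasStrictDerivAt 0 t).hasDerivAt.exp

theorem polarSol_zero (lam x : ℝ) : polarSol N Q lam x 0 = Real.sin x := by
  rw [polarSol, radius_zero, angle_zero hN hQ hB, one_mul]

theorem polarQuasi_zero (lam x : ℝ) : polarQuasi N Q lam x 0 = N * Real.cos x := by
  rw [polarQuasi, radius_zero, angle_zero hN hQ hB, one_mul]

theorem isQuasiSolution_polar (lam x : ℝ) :
    IsQuasiSolution Q lam (fun t => (polarSol N Q lam x t : ℂ))
      (fun t => (polarQuasi N Q lam x t : ℂ)) := by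
  have hr := hasDerivAt_radius hN hQ hB lam x
  have hθ := hasDerivAt_angle hN hQ hB lam x
  have hsc := fun t => Real.sin_sq_add_cos_sq (angle N Q lam x t)
  constructor
  · intro t
    have h : HasDerivAt (polarSol N Q lam x)
        (Q t * polarSol N Q lam x t + polarQuasi N Q lam x t) t := by
      refine ((hr t).mul (hθ t).sin).congr_deriv ?_
      simp only [radialRate, angleField, polarSol, polarQuasi]
      field_simp
      linear_combination radius N Q lam x t * N * (Q t * Real.sin (angle N Q lam x t) +
        N * Real.cos (angle N Q lam x t)) * hsc t
    exact h.ofReal_comp.congr_deriv (by push_cast; ring)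
  · intro t
    have h : HasDerivAt (polarQuasi N Q lam x)
        (-(lam + Q t ^ 2) * polarSol N Q lam x t - Q t * polarQuasi N Q lam x t) t := by
      refine (((hr t).mul (hθ t).cos).const_mul N).congr_deriv ?_
      simp only [radialRate, angleField, polarSol, polarQuasi]
      field_simp
      linear_combination radius N Q lam x t * (-((lam + Q t ^ 2) * Real.sin (angle N Q lam x t)) -
        Q t * N * Real.cos (angle N Q lam x t)) * hsc t
    exact h.ofReal_comp.congr_deriv (by push_cast; ring)

/-- A quasi-solution with vanishing initial data vanishes: its Wronskians with two independent
solutions are zero. -/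
theorem IsQuasiSolution.eq_zero {lam : ℝ} {y z : ℝ → ℂ} (h : IsQuasiSolution Q lam y z)
    (hy : y 0 = 0) (hz : z 0 = 0) (t : ℝ) : y t = 0 ∧ z t = 0 := by
  have hφ := isQuasiSolution_polar hN hQ hB lam 0
  have hψ := isQuasiSolution_polar hN hQ hB lam (Real.pi / 2)
  have h1 := h.wronskian_eq hφ t
  have h2 := h.wronskian_eq hψ t
  have h3 := hφ.wronskian_eq hψ t
  simp only [hy, hz, polarSol_zero hN hQ hB, polarQuasi_zero hN hQ hB] at h1 h2 h3
  simp only [zero_mul, sub_zero, Real.sin_zero, Real.cos_zero, mul_one,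
    Real.sin_pi_div_two, Complex.ofReal_one, Complex.ofReal_zero, zero_sub] at h1 h2 h3
  have hN' : (N : ℂ) ≠ 0 := Complex.ofReal_ne_zero.2 hN.ne'
  constructor
  · refine (mul_eq_zero.1 (?_ : (N : ℂ) * y t = 0)).resolve_left hN'
    linear_combination (polarSol N Q lam (Real.pi / 2) t : ℂ) * h1 -
      (polarSol N Q lam 0 t : ℂ) * h2 + y t * h3
  · refine (mul_eq_zero.1 (?_ : (N : ℂ) * z t = 0)).resolve_left hN'
    linear_combination (polarQuasi N Q lam (Real.pi / 2) t : ℂ) * h1 -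
      (polarQuasi N Q lam 0 t : ℂ) * h2 + z t * h3

/-- Every solution is a linear combination of the two solutions with initial angles `π / 2`
and `0`. -/
theorem IsQuasiSolution.eq_comb {lam : ℝ} {y z : ℝ → ℂ} (h : IsQuasiSolution Q lam y z) (t : ℝ) :
    y t = y 0 * polarSol N Q lam (Real.pi / 2) t + z 0 / N * polarSol N Q lam 0 t ∧
      z t = y 0 * polarQuasi N Q lam (Real.pi / 2) t + z 0 / N * polarQuasi N Q lam 0 t := by
  have hN' : (N : ℂ) ≠ 0 := Complex.ofReal_ne_zero.2 hN.ne'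
  have hφ := (isQuasiSolution_polar hN hQ hB lam 0).const_mul (-(z 0 / N))
  have hψ := (isQuasiSolution_polar hN hQ hB lam (Real.pi / 2)).const_mul (-(y 0))
  obtain ⟨h1, h2⟩ := IsQuasiSolution.eq_zero hN hQ hB ((h.add hψ).add hφ)
    (by simp [polarSol_zero hN hQ hB])
    (by simp only [polarQuasi_zero hN hQ hB]; simp; field_simp; ring) t
  exact ⟨by linear_combination h1, by linear_combination h2⟩

end

/-! ### Carathéodory solutions and the regularised system -/

/-- The standing assumptions on a locally integrable potential `q` and its primitive `Q`. -/
structure IsPrimitive (q Q : ℝ → ℝ) : Prop where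
  intervalIntegrable : ∀ s t, IntervalIntegrable q volume s t
  eq_integral : ∀ x, Q x = ∫ t in (0 : ℝ)..x, q t

namespace IsPrimitive

variable {q Q : ℝ → ℝ} (h : IsPrimitive q Q)
include h

theorem absolutelyContinuous (s t : ℝ) : AbsolutelyContinuousOnInterval Q s t := by
  have hs : Q = fun x => ∫ t in (0 : ℝ)..x, q t := funext h.eq_integral
  have h1 : AbsolutelyContinuousOnInterval (fun x => ∫ t in (0 : ℝ)..x, q t)
      (min 0 (min s t)) (max 0 (max s t)) :=
    (h.intervalIntegrable _ _).absolutelyContinuousOnInterval_intervalIntegral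
      (Set.mem_uIcc.2 (Or.inl ⟨min_le_left _ _, le_max_left _ _⟩))
  rw [hs]
  refine h1.mono ?_
  rw [Set.uIcc_of_le (((min_le_left _ _).trans (le_max_left _ _) :
    min 0 (min s t) ≤ max 0 (max s t)))]
  exact Set.Icc_subset_Icc (min_le_right _ _) (le_max_right _ _)

theorem continuous : Continuous Q := by
  rw [funext h.eq_integral]
  exact intervalIntegral.continuous_primitive h.intervalIntegrable 0

theorem ae_hasDerivAt : ∀ᵐ x, HasDerivAt Q (q x) x := by
  have hl : LocallyIntegrable q volume := by
    intro x
    refine ⟨Set.Ioc (x - 1) (x + 1), mem_of_superset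
      (Ioo_mem_nhds (by linarith) (by linarith)) Set.Ioo_subset_Ioc_self, ?_⟩
    exact (intervalIntegrable_iff_integrableOn_Ioc_of_le (by linarith)).1
      (h.intervalIntegrable (x - 1) (x + 1))
  filter_upwards [LocallyIntegrable.ae_hasDerivAt_integral hl] with x hx
  rw [funext h.eq_integral]
  exact hx 0

end IsPrimitive

/-- If an absolutely continuous function has a.e. the derivative `g` with `g` continuous, then it
is everywhere differentiable with derivative `g`. -/
theorem hasDerivAt_of_ae_of_continuous {f g : ℝ → ℂ}
    (hf : ∀ s t, AbsolutelyContinuousOnInterval f s t) (hg : Continuous g)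
    (hfg : ∀ᵐ x, HasDerivAt f (g x) x) (x : ℝ) : HasDerivAt f (g x) x := by
  set F : ℝ → ℂ := fun x => ∫ t in (0 : ℝ)..x, g t
  have hF : ∀ x, HasDerivAt F (g x) x := fun x => (hg.integral_hasStrictDerivAt 0 x).hasDerivAt
  have hFC : ContDiff ℝ 1 F := contDiff_one_iff_deriv.2
    ⟨fun x => (hF x).differentiableAt, by rwa [funext fun x => (hF x).deriv]⟩
  obtain ⟨C, hC⟩ := ((hf (x - 1) (x + 1)).sub
    hFC.contDiffOn.absolutelyContinuousOnInterval).const_of_ae_hasDerivAt_zero (by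
      filter_upwards [hfg] with s hs _
      simpa using hs.sub (hF s))
  refine ((hF x).add_const C).congr_of_eventuallyEq ?_
  filter_upwards [Ioo_mem_nhds (by linarith : x - 1 < x) (by linarith : x < x + 1)] with s hs
  have := hC s (Set.mem_uIcc.2 (Or.inl ⟨hs.1.le, hs.2.le⟩))
  rw [← this]
  simp

theorem IsSolution.isQuasiSolution {q Q : ℝ → ℝ} (h : IsPrimitive q Q) {lam : ℝ} {y : ℝ → ℂ}
    (hy : IsSolution q lam y) :
    IsQuasiSolution Q lam y (fun t => deriv y t - Q t * y t) := by
  obtain ⟨h1, h2, h3⟩ := hy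
  have hyc : Continuous (deriv y) := by
    rw [continuous_iff_continuousAt]
    intro x
    exact ((h2 (x - 1) (x + 1)).continuousOn).continuousAt (by
      rw [Set.uIcc_of_le (by linarith)]
      exact Icc_mem_nhds (by linarith) (by linarith))
  have hyC : ContDiff ℝ 1 y := contDiff_one_iff_deriv.2 ⟨h1, hyc⟩
  refine ⟨fun t => (h1 t).hasDerivAt.congr_deriv (by ring), fun t => ?_⟩
  refine hasDerivAt_of_ae_of_continuous (f := fun t => deriv y t - Q t * y t)
    (g := fun t => -(lam + (Q t : ℂ) ^ 2) * y t - Q t * (deriv y t - Q t * y t))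
    (fun s t => ?_) ?_ ?_ t
  · have := (h.absolutelyContinuous s t).fun_smul
      (hyC.contDiffOn (s := Set.uIcc s t)).absolutelyContinuousOnInterval
    simpa only [Complex.real_smul] using (h2 s t).fun_sub this
  · have := h1.continuous
    have := h.continuous
    fun_prop
  · filter_upwards [h3, h.ae_hasDerivAt] with s hs hq
    refine (hs.sub (hq.ofReal_comp.mul (h1 s).hasDerivAt)).congr_deriv ?_
    push_cast
    ring

theorem IsQuasiSolution.isSolution {q Q : ℝ → ℝ} (h : IsPrimitive q Q) {lam : ℝ} {y z : ℝ → ℂ}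
    (hy : IsQuasiSolution Q lam y z) : IsSolution q lam y := by
  obtain ⟨h1, h2⟩ := hy
  have hd : deriv y = fun t => Q t * y t + z t := funext fun t => (h1 t).deriv
  have hQ := h.continuous
  have hyc : Continuous y := continuous_iff_continuousAt.2 fun t => (h1 t).continuousAt
  have hzc : Continuous z := continuous_iff_continuousAt.2 fun t => (h2 t).continuousAt
  have hyC : ContDiff ℝ 1 y := contDiff_one_iff_deriv.2
    ⟨fun t => (h1 t).differentiableAt, by rw [hd]; fun_prop⟩
  have hzC : ContDiff ℝ 1 z := contDiff_one_iff_deriv.2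
    ⟨fun t => (h2 t).differentiableAt, by rw [funext fun t => (h2 t).deriv]; fun_prop⟩
  refine ⟨fun t => (h1 t).differentiableAt, fun s t => ?_, ?_⟩
  · have := (h.absolutelyContinuous s t).fun_smul
      (hyC.contDiffOn (s := Set.uIcc s t)).absolutelyContinuousOnInterval
    rw [hd]
    simpa only [Complex.real_smul] using
      this.fun_add (hzC.contDiffOn (s := Set.uIcc s t)).absolutelyContinuousOnInterval
  · filter_upwards [h.ae_hasDerivAt] with s hq
    rw [hd]
    refine ((hq.ofReal_comp.mul (h1 s)).add (h2 s)).congr_deriv ?_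
    push_cast
    ring

end

/-! ### Extremal rotation of a unimodular matrix acting on directions -/

/-- The real matrix `(s, p; s', p')` of determinant `1` sends the unit vector with angle `x`
(measured so that the vector is `(sin x, cos x)`) to the vector with length `R x` and angle
`x + rot x`; the rotation `rot` oscillates by less than `π`. -/
structure IsPolarAction (s p s' p' : ℝ) (R rot : ℝ → ℝ) : Prop where
  det : s * p' - p * s' = 1
  pos : ∀ x, 0 < R x
  sin_eq : ∀ x, R x * Real.sin (x + rot x) = s * Real.sin x + p * Real.cos x
  cos_eq : ∀ x, R x * Real.cos (x + rot x) = s' * Real.sin x + p' * Real.cos x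
  osc : ∀ x x', |rot x - rot x'| < Real.pi

theorem sin_eq_zero_of_cos_eq {v σ : ℝ} (hσ : σ ^ 2 = 1) (h : Real.cos v = σ) :
    Real.sin v = 0 := by
  have := Real.sin_sq_add_cos_sq v
  rw [h, hσ] at this
  exact pow_eq_zero_iff two_ne_zero |>.1 (by linarith)

theorem eq_of_cos_eq {v w σ : ℝ} (hσ : σ ^ 2 = 1) (hv : Real.cos v = σ) (hw : Real.cos w = σ)
    (h : |v - w| < 2 * Real.pi) : v = w := by
  have h1 : Real.cos (v - w) = 1 := by
    rw [Real.cos_sub, hv, hw, sin_eq_zero_of_cos_eq hσ hv]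
    linarith
  have := abs_lt.1 h
  have h2 := (Real.cos_eq_one_iff_of_lt_of_lt (by linarith) (by linarith)).1 h1
  linarith

/-- The complex vectors `v` with `M v = σ v`, where `M = (s, p; s', p')`. -/
def fixedSpace (s p s' p' σ : ℝ) : Submodule ℂ (ℂ × ℂ) where
  carrier := {v | s * v.1 + p * v.2 = σ * v.1 ∧ s' * v.1 + p' * v.2 = σ * v.2}
  zero_mem' := by simp
  add_mem' := by
    rintro v w ⟨h1, h2⟩ ⟨h3, h4⟩
    exact ⟨by simp only [Prod.fst_add, Prod.snd_add]; linear_combination h1 + h3,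
      by simp only [Prod.fst_add, Prod.snd_add]; linear_combination h2 + h4⟩
  smul_mem' := by
    rintro c v ⟨h1, h2⟩
    exact ⟨by simp only [Prod.smul_fst, Prod.smul_snd, smul_eq_mul]; linear_combination c * h1,
      by simp only [Prod.smul_fst, Prod.smul_snd, smul_eq_mul]; linear_combination c * h2⟩

theorem ofReal_mem_fixedSpace {s p s' p' σ X Y : ℝ} :
    ((X : ℂ), (Y : ℂ)) ∈ fixedSpace s p s' p' σ ↔
      s * X + p * Y = σ * X ∧ s' * X + p' * Y = σ * Y := by
  change (s : ℂ) * X + p * Y = σ * X ∧ (s' : ℂ) * X + p' * Y = σ * Y ↔ _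
  norm_cast

namespace IsPolarAction

variable {s p s' p' : ℝ} {R rot : ℝ → ℝ} (h : IsPolarAction s p s' p' R rot)
include h

/-- The quadratic form `det (v, M v)` in polar coordinates. -/
theorem sin_rot (x : ℝ) : R x * Real.sin (rot x) =
    p * Real.cos x ^ 2 + (s - p') * (Real.sin x * Real.cos x) - s' * Real.sin x ^ 2 := by
  have h1 : Real.sin (rot x) = Real.sin (x + rot x) * Real.cos x -
      Real.cos (x + rot x) * Real.sin x := by rw [← Real.sin_sub]; congr 1; ring
  rw [h1]
  linear_combination Real.cos x * h.sin_eq x - Real.sin x * h.cos_eq x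

theorem mul_sin_sub {v σ : ℝ} (hσ : σ ^ 2 = 1) (hv : Real.cos v = σ) (x : ℝ) :
    R x * Real.sin (rot x - v) = σ *
    (p * Real.cos x ^ 2 + (s - p') * (Real.sin x * Real.cos x) - s' * Real.sin x ^ 2) := by
  rw [← h.sin_rot, Real.sin_sub, hv, sin_eq_zero_of_cos_eq hσ hv]
  ring

theorem eigen_of_cos_rot {σ x : ℝ} (hσ : σ ^ 2 = 1) (hx : Real.cos (rot x) = σ) :
    s * Real.sin x + p * Real.cos x = R x * σ * Real.sin x ∧
      s' * Real.sin x + p' * Real.cos x = R x * σ * Real.cos x := by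
  rw [← h.sin_eq, ← h.cos_eq, Real.sin_add, Real.cos_add, hx, sin_eq_zero_of_cos_eq hσ hx]
  constructor <;> ring

omit h in
/-- An eigenvalue is a root of the characteristic polynomial. -/
theorem charpoly_eq_zero {ρ X Y : ℝ} (hXY : X ^ 2 + Y ^ 2 = 1) (h1 : s * X + p * Y = ρ * X)
    (h2 : s' * X + p' * Y = ρ * Y) : (s - ρ) * (p' - ρ) - p * s' = 0 := by
  linear_combination (X * (p' - ρ) - s' * Y) * h1 + (Y * (s - ρ) - p * X) * h2 -
    ((s - ρ) * (p' - ρ) - p * s') * hXY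

/-- If the rotation is extremal at `x₀` and is there a multiple of `π` with cosine `σ`, then
`(sin x₀, cos x₀)` is an eigenvector with eigenvalue `σ`: the quadratic form `det (v, M v)` is
semidefinite, so `(tr M)² ≤ 4`, which forces the real eigenvalue `R x₀ σ` to be `±1`. -/
theorem radius_eq_one {σ x₀ : ℝ} (hσ : σ ^ 2 = 1) (hx : Real.cos (rot x₀) = σ)
    (hext : (∀ x, rot x ≤ rot x₀) ∨ ∀ x, rot x₀ ≤ rot x) : R x₀ = 1 := by
  have hdisc : discrim (-s') (s - p') p ≤ 0 := by
    have hform : ∀ X : ℝ, -s' * (X * X) + (s - p') * X + p =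
        σ * (R (Real.arctan X) * Real.sin (rot (Real.arctan X) - rot x₀)) /
          Real.cos (Real.arctan X) ^ 2 := by
      intro X
      have hc := (Real.cos_arctan_pos X).ne'
      have ht : Real.sin (Real.arctan X) = X * Real.cos (Real.arctan X) := by
        rw [← Real.tan_mul_cos hc, Real.tan_arctan]
      rw [h.mul_sin_sub hσ hx, ht, eq_div_iff (pow_ne_zero 2 hc)]
      linear_combination (-(p * Real.cos (Real.arctan X) ^ 2 + (s - p') *
        (X * Real.cos (Real.arctan X) * Real.cos (Real.arctan X)) -
        s' * (X * Real.cos (Real.arctan X)) ^ 2)) * hσ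
    have hσ' : σ = 1 ∨ σ = -1 := mul_self_eq_one_iff.1 ((sq σ).symm.trans hσ)
    -- the form has the constant sign `∓σ`
    have hsign : (∀ X : ℝ, 0 ≤ -s' * (X * X) + (s - p') * X + p) ∨
        ∀ X : ℝ, 0 ≤ s' * (X * X) + (-(s - p')) * X + (-p) := by
      have hneg : ∀ X : ℝ, s' * (X * X) + (-(s - p')) * X + (-p) =
        -(-s' * (X * X) + (s - p') * X + p) := fun X => by ring
      simp only [hneg, hform]
      have hle : (∀ x, R x * Real.sin (rot x - rot x₀) ≤ 0) ∨
          ∀ x, 0 ≤ R x * Real.sin (rot x - rot x₀) := by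
        rcases hext with he | he
        · left
          intro x
          have := (abs_lt.1 (h.osc x x₀)).1
          exact mul_nonpos_of_nonneg_of_nonpos (h.pos x).le
            (Real.sin_nonpos_of_nonpos_of_neg_pi_le (by linarith [he x]) this.le)
        · right
          intro x
          have := (abs_lt.1 (h.osc x x₀)).2
          exact mul_nonneg (h.pos x).le
            (Real.sin_nonneg_of_nonneg_of_le_pi (by linarith [he x]) this.le)
      rcases hσ' with rfl | rfl <;> rcases hle with hl | hl
      · right; intro X; rw [← neg_div]
        exact div_nonneg (by linarith [hl (Real.arctan X)]) (sq_nonneg _)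
      · left; intro X; exact div_nonneg (by linarith [hl (Real.arctan X)]) (sq_nonneg _)
      · left; intro X; exact div_nonneg (by linarith [hl (Real.arctan X)]) (sq_nonneg _)
      · right; intro X; rw [← neg_div]
        exact div_nonneg (by linarith [hl (Real.arctan X)]) (sq_nonneg _)
    rcases hsign with hs | hs
    · exact discrim_le_zero hs
    · have := discrim_le_zero hs
      simp only [discrim] at this ⊢
      linarith
  obtain ⟨h1, h2⟩ := h.eigen_of_cos_rot hσ hx
  have h3 := charpoly_eq_zero (Real.sin_sq_add_cos_sq x₀) h1 h2
  have hdet := h.det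
  set ρ := R x₀ * σ with hρ
  have h4 : ρ ^ 2 + 1 = (s + p') * ρ := by linear_combination h3 - hdet
  have h5 : (s + p') ^ 2 ≤ 4 := by
    simp only [discrim] at hdisc
    linarith
  have h6 : (ρ ^ 2 - 1) ^ 2 ≤ 0 := by
    have : (ρ ^ 2 + 1) ^ 2 ≤ 4 * ρ ^ 2 := by
      rw [h4, mul_pow]; exact mul_le_mul_of_nonneg_right h5 (sq_nonneg _)
    linarith
  have h7 : ρ ^ 2 - 1 = 0 := pow_eq_zero_iff two_ne_zero |>.1 (le_antisymm h6 (sq_nonneg _))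
  have h8 : R x₀ ^ 2 = 1 := by
    rw [hρ, mul_pow, hσ] at h7; linarith
  nlinarith [h.pos x₀]

theorem of_eigen {σ x₀ : ℝ} (hσ : σ ^ 2 = 1)
    (h1 : s * Real.sin x₀ + p * Real.cos x₀ = σ * Real.sin x₀)
    (h2 : s' * Real.sin x₀ + p' * Real.cos x₀ = σ * Real.cos x₀) :
    R x₀ = 1 ∧ Real.cos (rot x₀) = σ := by
  have h3 := h.sin_eq x₀
  have h4 := h.cos_eq x₀
  rw [h1] at h3
  rw [h2] at h4
  have h5 := Real.sin_sq_add_cos_sq x₀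
  have h6 := Real.sin_sq_add_cos_sq (x₀ + rot x₀)
  have h7 : R x₀ ^ 2 = 1 := by
    linear_combination (-R x₀ ^ 2) * h6 + (R x₀ * Real.sin (x₀ + rot x₀) + σ * Real.sin x₀) * h3 +
      (R x₀ * Real.cos (x₀ + rot x₀) + σ * Real.cos x₀) * h4 + σ ^ 2 * h5 + hσ
  have h8 : R x₀ = 1 := by nlinarith [h.pos x₀]
  refine ⟨h8, ?_⟩
  have h9 : Real.cos (rot x₀) = Real.cos (x₀ + rot x₀) * Real.cos x₀ +
      Real.sin (x₀ + rot x₀) * Real.sin x₀ := by rw [← Real.cos_sub]; congr 1; ring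
  rw [h8] at h3 h4
  rw [h9]
  linear_combination Real.sin x₀ * h3 + Real.cos x₀ * h4 + σ * h5

/-- Conversely, at an eigenvector with eigenvalue `σ = ±1` the rotation is extremal: now
`(tr M)² = 4`, so the quadratic form `det (v, M v)` is semidefinite. -/
theorem extremal_of_eigen {σ x₀ : ℝ} (hσ : σ ^ 2 = 1)
    (h1 : s * Real.sin x₀ + p * Real.cos x₀ = σ * Real.sin x₀)
    (h2 : s' * Real.sin x₀ + p' * Real.cos x₀ = σ * Real.cos x₀) :
    (∀ x, rot x ≤ rot x₀) ∨ ∀ x, rot x₀ ≤ rot x := by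
  obtain ⟨-, hx⟩ := h.of_eigen hσ h1 h2
  have h3 := charpoly_eq_zero (Real.sin_sq_add_cos_sq x₀) h1 h2
  have htr : (s + p') * σ = 2 := by linear_combination h.det - h3 + hσ
  have hdisc : (s - p') ^ 2 + 4 * (p * s') = 0 := by
    have : (s + p') ^ 2 = 4 := by
      linear_combination (-(s + p') ^ 2) * hσ + ((s + p') * σ + 2) * htr
    linear_combination this - 4 * h.det
  have hform : (∀ x, 0 ≤ R x * Real.sin (rot x - rot x₀)) ∨
      ∀ x, R x * Real.sin (rot x - rot x₀) ≤ 0 := by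
    simp only [h.mul_sin_sub hσ hx]
    have hF : (∀ X Y : ℝ, 0 ≤ p * Y ^ 2 + (s - p') * (X * Y) - s' * X ^ 2) ∨
        ∀ X Y : ℝ, p * Y ^ 2 + (s - p') * (X * Y) - s' * X ^ 2 ≤ 0 := by
      have hsq : ∀ X Y : ℝ, 4 * p * (p * Y ^ 2 + (s - p') * (X * Y) - s' * X ^ 2) =
          (2 * p * Y + (s - p') * X) ^ 2 := fun X Y => by linear_combination (-X ^ 2) * hdisc
      rcases lt_trichotomy p 0 with hp | hp | hp
      · right; intro X Y
        have := hsq X Y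
        nlinarith [sq_nonneg (2 * p * Y + (s - p') * X)]
      · have hs : s - p' = 0 := by
          rw [hp] at hdisc; exact pow_eq_zero_iff two_ne_zero |>.1 (by linarith)
        rw [hp, hs]
        rcases le_total 0 s' with hs' | hs'
        · right; intro X Y; nlinarith [mul_nonneg hs' (sq_nonneg X)]
        · left; intro X Y; nlinarith [mul_nonneg (neg_nonneg.2 hs') (sq_nonneg X)]
      · left; intro X Y
        have := hsq X Y
        by_contra! hlt
        nlinarith [sq_nonneg (2 * p * Y + (s - p') * X)]
    rcases mul_self_eq_one_iff.1 ((sq σ).symm.trans hσ) with rfl | rfl <;> rcases hF with hF | hF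
    · left; intro x; linarith [hF (Real.sin x) (Real.cos x)]
    · right; intro x; linarith [hF (Real.sin x) (Real.cos x)]
    · right; intro x; linarith [hF (Real.sin x) (Real.cos x)]
    · left; intro x; linarith [hF (Real.sin x) (Real.cos x)]
  rcases hform with hf | hf
  · right
    intro x
    by_contra! hlt
    have := (abs_lt.1 (h.osc x x₀)).1
    exact absurd (hf x) (not_le.2 (mul_neg_of_pos_of_neg (h.pos x)
      (Real.sin_neg_of_neg_of_neg_pi_lt (by linarith) this)))
  · left
    intro x
    by_contra! hlt
    have := (abs_lt.1 (h.osc x x₀)).2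
    exact absurd (hf x) (not_le.2 (mul_pos (h.pos x)
      (Real.sin_pos_of_pos_of_lt_pi (by linarith) this)))

omit h in
theorem exists_polar_of_ne_zero {X Y : ℝ} (hXY : ¬(X = 0 ∧ Y = 0)) :
    ∃ r x : ℝ, r ≠ 0 ∧ X = r * Real.sin x ∧ Y = r * Real.cos x := by
  have hz : (⟨Y, X⟩ : ℂ) ≠ 0 := fun hz => hXY ⟨congrArg Complex.im hz, congrArg Complex.re hz⟩
  exact ⟨‖(⟨Y, X⟩ : ℂ)‖, Complex.arg ⟨Y, X⟩, norm_ne_zero_iff.2 hz,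
    (Complex.norm_mul_sin_arg ⟨Y, X⟩).symm, (Complex.norm_mul_cos_arg ⟨Y, X⟩).symm⟩

/-- The dimension of the space of fixed vectors of `σ⁻¹ M` is the number of extremal rotations with
cosine `σ`. It is `2` only if `M = σ`, in which case the rotation is constant. -/
theorem finrank_fixedSpace {σ xU xL : ℝ} (hσ : σ ^ 2 = 1) (hU : ∀ x, rot x ≤ rot xU)
    (hL : ∀ x, rot xL ≤ rot x) [Decidable (Real.cos (rot xU) = σ)]
    [Decidable (Real.cos (rot xL) = σ)] :
    Module.finrank ℂ (fixedSpace s p s' p' σ) =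
      (if Real.cos (rot xU) = σ then 1 else 0) + if Real.cos (rot xL) = σ then 1 else 0 := by
  have hne : ∀ x₀, Real.cos (rot x₀) = σ → ((∀ x, rot x ≤ rot x₀) ∨ ∀ x, rot x₀ ≤ rot x) →
      fixedSpace s p s' p' σ ≠ ⊥ := by
    intro x₀ hx hext hbot
    obtain ⟨h1, h2⟩ := h.eigen_of_cos_rot hσ hx
    rw [h.radius_eq_one hσ hx hext, one_mul] at h1 h2
    have hmem : ((Real.sin x₀ : ℂ), (Real.cos x₀ : ℂ)) ∈ fixedSpace s p s' p' σ :=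
      ofReal_mem_fixedSpace.2 ⟨h1, h2⟩
    rw [hbot, Submodule.mem_bot] at hmem
    have h3 := Real.sin_sq_add_cos_sq x₀
    have h4 : Real.sin x₀ = 0 := Complex.ofReal_eq_zero.1 (congrArg Prod.fst hmem)
    have h5 : Real.cos x₀ = 0 := Complex.ofReal_eq_zero.1 (congrArg Prod.snd hmem)
    rw [h4, h5] at h3
    norm_num at h3
  have hex : fixedSpace s p s' p' σ ≠ ⊥ →
      Real.cos (rot xU) = σ ∨ Real.cos (rot xL) = σ := by
    intro hb
    obtain ⟨v, ⟨hv1, hv2⟩, hv0⟩ := Submodule.exists_mem_ne_zero_of_ne_bot hb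
    -- the real or the imaginary part of `v` is a nonzero real fixed vector
    have hreal : ∃ X Y : ℝ, ¬(X = 0 ∧ Y = 0) ∧ s * X + p * Y = σ * X ∧
        s' * X + p' * Y = σ * Y := by
      have hre1 := congrArg Complex.re hv1
      have hre2 := congrArg Complex.re hv2
      have him1 := congrArg Complex.im hv1
      have him2 := congrArg Complex.im hv2
      simp only [Complex.add_re, Complex.re_ofReal_mul, Complex.add_im,
        Complex.im_ofReal_mul] at hre1 hre2 him1 him2
      by_cases hr : v.1.re = 0 ∧ v.2.re = 0
      · refine ⟨v.1.im, v.2.im, fun hi => hv0 ?_, him1, him2⟩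
        exact Prod.ext (Complex.ext hr.1 hi.1) (Complex.ext hr.2 hi.2)
      · exact ⟨v.1.re, v.2.re, hr, hre1, hre2⟩
    obtain ⟨X, Y, hXY, h1, h2⟩ := hreal
    obtain ⟨r, x₀, hr, rfl, rfl⟩ := exists_polar_of_ne_zero hXY
    have h1' : s * Real.sin x₀ + p * Real.cos x₀ = σ * Real.sin x₀ :=
      mul_left_cancel₀ hr (by linear_combination h1)
    have h2' : s' * Real.sin x₀ + p' * Real.cos x₀ = σ * Real.cos x₀ :=
      mul_left_cancel₀ hr (by linear_combination h2)
    obtain ⟨-, hx⟩ := h.of_eigen hσ h1' h2'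
    rcases h.extremal_of_eigen hσ h1' h2' with he | he
    · left; rw [← hx, le_antisymm (he xU) (hU x₀)]
    · right; rw [← hx, le_antisymm (hL x₀) (he xL)]
  have htop : fixedSpace s p s' p' σ = ⊤ ↔ Real.cos (rot xU) = σ ∧ Real.cos (rot xL) = σ := by
    constructor
    · intro ht
      have hall : ∀ x, Real.cos (rot x) = σ := by
        intro x
        have hmem : ((Real.sin x : ℂ), (Real.cos x : ℂ)) ∈ fixedSpace s p s' p' σ := by
          rw [ht]; trivial
        exact (h.of_eigen hσ (ofReal_mem_fixedSpace.1 hmem).1 (ofReal_mem_fixedSpace.1 hmem).2).2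
      exact ⟨hall _, hall _⟩
    · rintro ⟨hcU, hcL⟩
      have hUL : rot xU = rot xL := eq_of_cos_eq hσ hcU hcL
        ((h.osc _ _).trans (by linarith [Real.pi_pos]))
      have hconst : ∀ x, rot x = rot xU := fun x =>
        le_antisymm (hU x) (by rw [hUL]; exact hL x)
      have heig : ∀ x, s * Real.sin x + p * Real.cos x = σ * Real.sin x ∧
          s' * Real.sin x + p' * Real.cos x = σ * Real.cos x := by
        intro x
        have hx : Real.cos (rot x) = σ := by rw [hconst x, hcU]
        have hR := h.radius_eq_one hσ hx (Or.inl fun y => by rw [hconst y, hconst x])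
        have := h.eigen_of_cos_rot hσ hx
        rwa [hR, one_mul] at this
      obtain ⟨h1, h2⟩ := heig 0
      obtain ⟨h3, h4⟩ := heig (Real.pi / 2)
      simp only [Real.sin_zero, Real.cos_zero, mul_zero, mul_one, zero_add, Real.sin_pi_div_two,
        Real.cos_pi_div_two, add_zero] at h1 h2 h3 h4
      rw [eq_top_iff]
      rintro v -
      exact ⟨by rw [h1, h3]; simp, by rw [h2, h4]; simp⟩
  have hdim : Module.finrank ℂ (ℂ × ℂ) = 2 := by simp
  by_cases hcU : Real.cos (rot xU) = σ <;> by_cases hcL : Real.cos (rot xL) = σ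
  · rw [htop.2 ⟨hcU, hcL⟩, finrank_top, hdim, if_pos hcU, if_pos hcL]
  · rw [if_pos hcU, if_neg hcL]
    have h1 := Submodule.finrank_lt fun ht => hcL (htop.1 ht).2
    have h2 := Submodule.one_le_finrank_iff.2 (hne xU hcU (Or.inl hU))
    omega
  · rw [if_neg hcU, if_pos hcL]
    have h1 := Submodule.finrank_lt fun ht => hcU (htop.1 ht).1
    have h2 := Submodule.one_le_finrank_iff.2 (hne xL hcL (Or.inr hL))
    omega
  · rw [if_neg hcU, if_neg hcL]
    have : fixedSpace s p s' p' σ = ⊥ := by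
      by_contra hb
      rcases hex hb with h' | h'
      · exact hcU h'
      · exact hcL h'
    rw [this, finrank_bot]

end IsPolarAction

/-! ### Counting eigenvalues through extremal rotations -/

/-- The properties of the extremal rotations `U ≥ L`, as functions of the spectral parameter,
that determine the position of the eigenvalues. The last one rules out eigenvalues near `-∞`. -/
structure IsRotationPair (U L : ℝ → ℝ) : Prop where
  strictMono_max : StrictMono U
  strictMono_min : StrictMono L
  continuous_max : Continuous U
  continuous_min : Continuous L
  max_pos : ∀ lam, 0 < U lam
  min_gt : ∀ lam, -Real.pi < L lam
  min_le_max : ∀ lam, L lam ≤ U lam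
  max_lt : ∀ lam, U lam < L lam + Real.pi
  exists_small : ∃ lam, U lam < Real.pi ∧ L lam < 0

theorem cos_sub_two_mul_pi (n i : ℕ) : Real.cos (((n : ℝ) - 2 * i) * Real.pi) = (-1) ^ n := by
  have : ((n : ℝ) - 2 * i) * Real.pi = n * Real.pi - i * (2 * Real.pi) := by ring
  rw [this, Real.cos_sub_nat_mul_two_pi, Real.cos_nat_mul_pi]

theorem exists_eq_of_cos_eq {n : ℕ} {v : ℝ} (hv : Real.cos v = (-1) ^ n) :
    ∃ j : ℤ, v = ((n : ℝ) - 2 * j) * Real.pi := by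
  have h1 : Real.cos (n * Real.pi - v) = 1 := by
    rw [Real.cos_sub, Real.cos_nat_mul_pi, Real.sin_nat_mul_pi, hv, ← pow_add, zero_mul, add_zero,
      ← two_mul, pow_mul]
    norm_num
  obtain ⟨j, hj⟩ := (Real.cos_eq_one_iff _).1 h1
  exact ⟨j, by linarith⟩

theorem injective_sub_two_mul_pi (n : ℕ) :
    Function.Injective fun i : ℕ => ((n : ℝ) - 2 * i) * Real.pi := by
  intro i j hij
  have := mul_right_cancel₀ Real.pi_ne_zero hij
  have h2 : (i : ℝ) = j := by linarith
  exact_mod_cast h2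

open Classical in
/-- A strictly monotone `f` takes each of the values `(n - 2 i) π` at most once, so the number of
points with `cos f = (-1) ^ n` is bounded by the number of admissible indices `i`. -/
theorem card_filter_cos_le {f : ℝ → ℝ} (hf : StrictMono f) {n : ℕ} {F : Finset ℝ}
    {I : Finset ℕ}
    (h : ∀ lam ∈ F, ∀ j : ℤ, f lam = ((n : ℝ) - 2 * j) * Real.pi → ∃ i ∈ I, (i : ℤ) = j) :
    (F.filter fun lam => Real.cos (f lam) = (-1) ^ n).card ≤ I.card := by
  rw [← Finset.card_image_of_injective _ hf.injective,
    ← Finset.card_image_of_injective I (injective_sub_two_mul_pi n)]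
  refine Finset.card_le_card fun v hv => ?_
  obtain ⟨lam, hlam, rfl⟩ := Finset.mem_image.1 hv
  obtain ⟨h1, h2⟩ := Finset.mem_filter.1 hlam
  obtain ⟨j, hj⟩ := exists_eq_of_cos_eq h2
  obtain ⟨i, hi, rfl⟩ := h lam h1 j hj
  exact Finset.mem_image.2 ⟨i, hi, by rw [hj]; simp⟩

open Classical in
theorem le_card_filter_cos {f : ℝ → ℝ} {n : ℕ} {F : Finset ℝ} {I : Finset ℕ}
    (h : ∀ i ∈ I, ∃ lam ∈ F, f lam = ((n : ℝ) - 2 * i) * Real.pi) :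
    I.card ≤ (F.filter fun lam => Real.cos (f lam) = (-1) ^ n).card := by
  rw [← Finset.card_image_of_injective I (injective_sub_two_mul_pi n)]
  refine le_trans (Finset.card_le_card fun v hv => ?_)
    (Finset.card_image_le (f := f) (s := F.filter fun lam => Real.cos (f lam) = (-1) ^ n))
  obtain ⟨i, hi, rfl⟩ := Finset.mem_image.1 hv
  obtain ⟨lam, hlam, hv⟩ := h i hi
  exact Finset.mem_image.2 ⟨lam, Finset.mem_filter.2 ⟨hlam, by rw [hv, cos_sub_two_mul_pi]⟩, hv⟩

theorem int_lt_of_mul_pi_lt {b c : ℤ} (h : (b : ℝ) * Real.pi < c * Real.pi) : b < c := by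
  exact_mod_cast lt_of_mul_lt_mul_right h Real.pi_pos.le

namespace IsRotationPair

variable {U L : ℝ → ℝ} (h : IsRotationPair U L)
include h

theorem exists_max_eq {lam v : ℝ} (h1 : Real.pi ≤ v) (h2 : v ≤ U lam) :
    ∃ lam' ≤ lam, U lam' = v := by
  obtain ⟨l₀, h3, -⟩ := h.exists_small
  have hle : l₀ ≤ lam := h.strictMono_max.le_iff_le.1 (by linarith)
  obtain ⟨l, hl, hv⟩ := intermediate_value_Icc hle h.continuous_max.continuousOn
    ⟨(h3.le.trans h1), h2⟩
  exact ⟨l, hl.2, hv⟩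

theorem exists_min_eq {lam v : ℝ} (h1 : 0 ≤ v) (h2 : v ≤ L lam) :
    ∃ lam' ≤ lam, L lam' = v := by
  obtain ⟨l₀, -, h3⟩ := h.exists_small
  have hle : l₀ ≤ lam := h.strictMono_min.le_iff_le.1 (by linarith)
  obtain ⟨l, hl, hv⟩ := intermediate_value_Icc hle h.continuous_min.continuousOn
    ⟨(h3.le.trans h1), h2⟩
  exact ⟨l, hl.2, hv⟩

open Classical in
/-- An upper bound for the number of eigenvalues `≤ t`. Since `U > 0` and `L > -π`, only the values
`(n - 2 i) π` of `U` with `0 < n - 2 i < n + c` and those of `L` with `0 ≤ n - 2 i < n` can occur. -/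
theorem sum_le {n c : ℕ} {mult : ℝ → ℕ} {t : ℝ} {F : Finset ℝ}
    (hmult : ∀ lam, mult lam = (if Real.cos (U lam) = (-1) ^ n then 1 else 0) +
      if Real.cos (L lam) = (-1) ^ n then 1 else 0)
    (hU : ∀ lam ≤ t, U lam < (n + c : ℝ) * Real.pi)
    (hL : ∀ lam ≤ t, L lam < n * Real.pi) (hc : c ≤ 1) (hn : 1 ≤ n)
    (hF : ∀ lam ∈ F, lam ≤ t) : ∑ lam ∈ F, mult lam ≤ n - 1 + c := by
  simp only [hmult, Finset.sum_add_distrib, ← Finset.card_filter]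
  have h1 := card_filter_cos_le (n := n) (F := F) (I := Finset.Icc (1 - c) ((n - 1) / 2))
    h.strictMono_max (fun lam hlam j hj => by
      have h1 := h.max_pos lam
      have h2 := hU lam (hF lam hlam)
      rw [hj] at h1 h2
      have h3 : (0 : ℤ) < n - 2 * j := int_lt_of_mul_pi_lt (by push_cast; simpa using h1)
      have h4 : (n : ℤ) - 2 * j < n + c := int_lt_of_mul_pi_lt (by push_cast; simpa using h2)
      exact ⟨j.toNat, Finset.mem_Icc.2 (by omega), by omega⟩)
  have h2 := card_filter_cos_le (n := n) (F := F) (I := Finset.Icc 1 (n / 2))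
    h.strictMono_min (fun lam hlam j hj => by
      have h1 := h.min_gt lam
      have h2 := hL lam (hF lam hlam)
      rw [hj] at h1 h2
      have h3 : (-1 : ℤ) < n - 2 * j := int_lt_of_mul_pi_lt (by push_cast; linarith)
      have h4 : (n : ℤ) - 2 * j < n := int_lt_of_mul_pi_lt (by push_cast; simpa using h2)
      exact ⟨j.toNat, Finset.mem_Icc.2 (by omega), by omega⟩)
  rw [Nat.card_Icc] at h1 h2
  omega

open Classical in
/-- A lower bound for the number of eigenvalues `≤ t`. By the intermediate value theorem `U` and `L`
take all the values `(n - 2 i) π` that their size at `t` permits. -/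
theorem le_sum {n c : ℕ} {mult : ℝ → ℕ} {t : ℝ}
    (hmult : ∀ lam, mult lam = (if Real.cos (U lam) = (-1) ^ n then 1 else 0) +
      if Real.cos (L lam) = (-1) ^ n then 1 else 0)
    (hU : n * Real.pi ≤ U t) (hL : ((n : ℝ) - 2 * (1 - c : ℕ)) * Real.pi ≤ L t) (hc : c ≤ 1)
    (hn : 1 ≤ n) :
    ∃ F : Finset ℝ, (∀ lam ∈ F, lam ≤ t) ∧ n + c ≤ ∑ lam ∈ F, mult lam := by
  have hpi := Real.pi_pos
  have hexU : ∀ i : ℕ, ∃ lam ≤ t, i ∈ Finset.Icc 0 ((n - 1) / 2) →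
      U lam = ((n : ℝ) - 2 * i) * Real.pi := by
    intro i
    by_cases hi : i ∈ Finset.Icc 0 ((n - 1) / 2)
    · have h1 : 1 + 2 * i ≤ n := by have := (Finset.mem_Icc.1 hi).2; omega
      have h1' : (1 : ℝ) + 2 * i ≤ n := by exact_mod_cast h1
      have h0 : (0 : ℝ) ≤ i := Nat.cast_nonneg i
      obtain ⟨l, hl, hv⟩ := h.exists_max_eq (lam := t) (v := ((n : ℝ) - 2 * i) * Real.pi)
        (by nlinarith) (le_trans (by nlinarith) hU)
      exact ⟨l, hl, fun _ => hv⟩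
    · exact ⟨t, le_rfl, fun h => absurd h hi⟩
  have hexL : ∀ i : ℕ, ∃ lam ≤ t, i ∈ Finset.Icc (1 - c) (n / 2) →
      L lam = ((n : ℝ) - 2 * i) * Real.pi := by
    intro i
    by_cases hi : i ∈ Finset.Icc (1 - c) (n / 2)
    · have h1 : 2 * i ≤ n := by have := (Finset.mem_Icc.1 hi).2; omega
      have h1' : (2 : ℝ) * i ≤ n := by exact_mod_cast h1
      have h0 : ((1 - c : ℕ) : ℝ) ≤ i := by exact_mod_cast (Finset.mem_Icc.1 hi).1
      obtain ⟨l, hl, hv⟩ := h.exists_min_eq (lam := t) (v := ((n : ℝ) - 2 * i) * Real.pi)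
        (by nlinarith) (le_trans (by nlinarith) hL)
      exact ⟨l, hl, fun _ => hv⟩
    · exact ⟨t, le_rfl, fun h => absurd h hi⟩
  choose lU hlU hUv using hexU
  choose lL hlL hLv using hexL
  refine ⟨(Finset.Icc 0 ((n - 1) / 2)).image lU ∪ (Finset.Icc (1 - c) (n / 2)).image lL,
    fun lam hlam => ?_, ?_⟩
  · rcases Finset.mem_union.1 hlam with hl | hl <;> obtain ⟨i, -, rfl⟩ := Finset.mem_image.1 hl
    · exact hlU i
    · exact hlL i
  · simp only [hmult, Finset.sum_add_distrib, ← Finset.card_filter]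
    have h1 := le_card_filter_cos (f := U) (n := n) (I := Finset.Icc 0 ((n - 1) / 2))
      (F := (Finset.Icc 0 ((n - 1) / 2)).image lU ∪ (Finset.Icc (1 - c) (n / 2)).image lL)
      (fun i hi => ⟨lU i, Finset.mem_union_left _ (Finset.mem_image_of_mem _ hi), hUv i hi⟩)
    have h2 := le_card_filter_cos (f := L) (n := n) (I := Finset.Icc (1 - c) (n / 2))
      (F := (Finset.Icc 0 ((n - 1) / 2)).image lU ∪ (Finset.Icc (1 - c) (n / 2)).image lL)
      (fun i hi => ⟨lL i, Finset.mem_union_right _ (Finset.mem_image_of_mem _ hi), hLv i hi⟩)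
    rw [Nat.card_Icc] at h1 h2
    omega

open Classical in
/-- The eigenvalue with index `n - 1` is the parameter where `U` reaches `n π`. -/
theorem isLeast_max {n : ℕ} {mult : ℝ → ℕ} {lam₀ : ℝ}
    (hmult : ∀ lam, mult lam = (if Real.cos (U lam) = (-1) ^ n then 1 else 0) +
      if Real.cos (L lam) = (-1) ^ n then 1 else 0)
    (hn : 1 ≤ n) (h₀ : U lam₀ = n * Real.pi) :
    IsLeast {t : ℝ | ∃ F : Finset ℝ, (∀ lam ∈ F, lam ≤ t) ∧ n - 1 + 1 ≤ ∑ lam ∈ F, mult lam}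
      lam₀ := by
  constructor
  · obtain ⟨F, hF, hs⟩ := h.le_sum (c := 0) hmult h₀.ge
      (by have := h.max_lt lam₀; push_cast; nlinarith [Real.pi_pos]) zero_le_one hn
    exact ⟨F, hF, by omega⟩
  · rintro t ⟨F, hF, hs⟩
    by_contra! hlt
    have := h.sum_le (c := 0) (t := t) hmult
      (fun lam hlam => by
        rw [Nat.cast_zero, add_zero, ← h₀]; exact h.strictMono_max (hlam.trans_lt hlt))
      (fun lam hlam => by
        rw [← h₀]; exact (h.min_le_max lam).trans_lt (h.strictMono_max (hlam.trans_lt hlt)))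
      zero_le_one hn hF
    omega

open Classical in
/-- The eigenvalue with index `n` is the parameter where `L` reaches `n π`. -/
theorem isLeast_min {n : ℕ} {mult : ℝ → ℕ} {lam₀ : ℝ}
    (hmult : ∀ lam, mult lam = (if Real.cos (U lam) = (-1) ^ n then 1 else 0) +
      if Real.cos (L lam) = (-1) ^ n then 1 else 0)
    (hn : 1 ≤ n) (h₀ : L lam₀ = n * Real.pi) :
    IsLeast {t : ℝ | ∃ F : Finset ℝ, (∀ lam ∈ F, lam ≤ t) ∧ n + 1 ≤ ∑ lam ∈ F, mult lam}
      lam₀ := by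
  constructor
  · exact h.le_sum (c := 1) hmult (h₀ ▸ h.min_le_max lam₀) (by simp [h₀]) le_rfl hn
  · rintro t ⟨F, hF, hs⟩
    by_contra! hlt
    have := h.sum_le (c := 1) (t := t) hmult
      (fun lam hlam => by
        have h1 := h.strictMono_min (hlam.trans_lt hlt)
        have h2 := h.max_lt lam
        rw [h₀] at h1
        push_cast
        linarith)
      (fun lam hlam => by rw [← h₀]; exact h.strictMono_min (hlam.trans_lt hlt))
      le_rfl hn hF
    omega

end IsRotationPair

/-! ### The rotation over one period -/

/-- The standing assumptions: `q` is a locally integrable potential of mean zero over the period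
`a`, `Q` is its primitive, bounded by `B`, and `N` is the scale of the Prüfer variables. -/
structure IsHillData (a N B : ℝ) (q Q : ℝ → ℝ) : Prop where
  period_pos : 0 < a
  scale_pos : 0 < N
  isPrimitive : IsPrimitive q Q
  bound : ∀ t, |Q t| ≤ B
  eq_zero : Q a = 0

/-- The increase over one period of the Prüfer angle starting at `x`. -/
def rotation (N : ℝ) (Q : ℝ → ℝ) (a lam x : ℝ) : ℝ := angle N Q lam x a - x

/-- The largest rotation over one period. The rotation is `π`-periodic in the initial angle, so the
initial angles in `[0, π]` suffice. -/
def maxRotation (N : ℝ) (Q : ℝ → ℝ) (a lam : ℝ) : ℝ :=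
  sSup (rotation N Q a lam '' Set.Icc 0 Real.pi)

/-- The smallest rotation over one period. -/
def minRotation (N : ℝ) (Q : ℝ → ℝ) (a lam : ℝ) : ℝ :=
  sInf (rotation N Q a lam '' Set.Icc 0 Real.pi)

/-- The solution with initial data `y 0 = v.1`, `y' 0 = N v.2`. -/
def solutionMap (N : ℝ) (Q : ℝ → ℝ) (lam : ℝ) : (ℂ × ℂ) →ₗ[ℂ] (ℝ → ℂ) where
  toFun v t := v.1 * polarSol N Q lam (Real.pi / 2) t + v.2 * polarSol N Q lam 0 t
  map_add' v w := by
    funext t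
    simp only [Prod.fst_add, Prod.snd_add, Pi.add_apply]
    ring
  map_smul' c v := by
    funext t
    simp only [Prod.smul_fst, Prod.smul_snd, Pi.smul_apply, smul_eq_mul, RingHom.id_apply]
    ring

namespace IsHillData

variable {a N B : ℝ} {q Q : ℝ → ℝ} (h : IsHillData a N B q Q)
include h

theorem continuous : Continuous Q := h.isPrimitive.continuous

theorem primitive_zero : Q 0 = 0 := by rw [h.isPrimitive.eq_integral]; simp

theorem periodic_rotation (lam : ℝ) : Function.Periodic (rotation N Q a lam) Real.pi := by
  intro x
  simp only [rotation, angle_add_pi h.scale_pos h.continuous h.bound]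
  ring

theorem continuous_rotation_param :
    Continuous fun p : ℝ × ℝ => rotation N Q a p.1 p.2 :=
  (continuous_angle_param h.scale_pos h.continuous h.bound h.period_pos.le).sub continuous_snd

theorem continuous_rotation (lam : ℝ) : Continuous (rotation N Q a lam) :=
  h.continuous_rotation_param.comp (by fun_prop : Continuous fun x : ℝ => (lam, x))

/-- The final angle increases with the initial one and commutes with the shift by `π`, so the
rotation oscillates by less than `π`. -/
theorem abs_rotation_sub_lt (lam x x' : ℝ) :
    |rotation N Q a lam x - rotation N Q a lam x'| < Real.pi := by
  obtain ⟨y, hy, hyx⟩ := (h.periodic_rotation lam).exists_mem_Ico Real.pi_pos x x'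
  rw [hyx]
  have hmono := angle_strictMono_init h.scale_pos h.continuous h.bound lam a
  have h1 : angle N Q lam x' a ≤ angle N Q lam y a := hmono.monotone hy.1
  have h2 : angle N Q lam y a < angle N Q lam (x' + Real.pi) a := hmono hy.2
  rw [angle_add_pi h.scale_pos h.continuous h.bound] at h2
  have h3 := hy.1
  have h4 := hy.2
  rw [abs_lt, rotation, rotation]
  constructor <;> linarith

theorem exists_maxRotation (lam : ℝ) : ∃ x₀, maxRotation N Q a lam = rotation N Q a lam x₀ ∧
    ∀ x, rotation N Q a lam x ≤ rotation N Q a lam x₀ := by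
  obtain ⟨x₀, -, h1, h2⟩ := isCompact_Icc.exists_sSup_image_eq_and_ge
    (Set.nonempty_Icc.2 Real.pi_pos.le) (h.continuous_rotation lam).continuousOn
  refine ⟨x₀, h1, fun x => ?_⟩
  obtain ⟨y, hy, hyx⟩ := (h.periodic_rotation lam).exists_mem_Ico₀ Real.pi_pos x
  rw [hyx]
  exact h2 y (Set.Ico_subset_Icc_self hy)

theorem exists_minRotation (lam : ℝ) : ∃ x₀, minRotation N Q a lam = rotation N Q a lam x₀ ∧
    ∀ x, rotation N Q a lam x₀ ≤ rotation N Q a lam x := by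
  obtain ⟨x₀, -, h1, h2⟩ := isCompact_Icc.exists_sInf_image_eq_and_le
    (Set.nonempty_Icc.2 Real.pi_pos.le) (h.continuous_rotation lam).continuousOn
  refine ⟨x₀, h1, fun x => ?_⟩
  obtain ⟨y, hy, hyx⟩ := (h.periodic_rotation lam).exists_mem_Ico₀ Real.pi_pos x
  rw [hyx]
  exact h2 y (Set.Ico_subset_Icc_self hy)

theorem rotation_strictMono (x : ℝ) : StrictMono fun lam => rotation N Q a lam x :=
  fun _ _ hl => sub_lt_sub_right
    (angle_strictMono_param h.scale_pos h.continuous h.bound hl x h.period_pos) _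

theorem isRotationPair : IsRotationPair (maxRotation N Q a) (minRotation N Q a) where
  strictMono_max := by
    intro l l' hl
    obtain ⟨x, hx, -⟩ := h.exists_maxRotation l
    obtain ⟨x', hx', hmax⟩ := h.exists_maxRotation l'
    rw [hx, hx']
    exact (h.rotation_strictMono x hl).trans_le (hmax x)
  strictMono_min := by
    intro l l' hl
    obtain ⟨x, hx, hmin⟩ := h.exists_minRotation l
    obtain ⟨x', hx', -⟩ := h.exists_minRotation l'
    rw [hx, hx']
    exact (hmin x').trans_lt (h.rotation_strictMono x' hl)
  continuous_max := isCompact_Icc.continuous_sSup h.continuous_rotation_param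
  continuous_min := isCompact_Icc.continuous_sInf h.continuous_rotation_param
  max_pos := by
    intro l
    obtain ⟨x, hx, hmax⟩ := h.exists_maxRotation l
    rw [hx]
    refine lt_of_lt_of_le ?_ (hmax 0)
    rw [rotation, sub_zero]
    exact angle_pos h.scale_pos h.continuous h.bound l h.period_pos
  min_gt := by
    intro l
    obtain ⟨x, hx, -⟩ := h.exists_minRotation l
    have h1 := angle_pos h.scale_pos h.continuous h.bound l h.period_pos
    have h2 := (abs_lt.1 (h.abs_rotation_sub_lt l x 0)).1
    rw [rotation, rotation, sub_zero] at h2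
    rw [hx, rotation]
    linarith
  min_le_max := by
    intro l
    obtain ⟨x, hx, hmin⟩ := h.exists_minRotation l
    obtain ⟨x', hx', -⟩ := h.exists_maxRotation l
    rw [hx, hx']
    exact hmin x'
  max_lt := by
    intro l
    obtain ⟨x, hx, -⟩ := h.exists_minRotation l
    obtain ⟨x', hx', -⟩ := h.exists_maxRotation l
    rw [hx, hx']
    linarith [(abs_lt.1 (h.abs_rotation_sub_lt l x' x)).2]
  exists_small := by
    refine ⟨-(B ^ 2) - 2, ?_⟩
    obtain ⟨x, hx, hmin⟩ := h.exists_minRotation (-(B ^ 2) - 2)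
    obtain ⟨x', hx', -⟩ := h.exists_maxRotation (-(B ^ 2) - 2)
    have h1 := angle_pi_div_two_lt h.scale_pos h.continuous h.bound le_rfl h.period_pos
    have h2 : rotation N Q a (-(B ^ 2) - 2) (Real.pi / 2) < 0 := by rw [rotation]; linarith
    rw [hx, hx']
    exact ⟨by linarith [(abs_lt.1 (h.abs_rotation_sub_lt (-(B ^ 2) - 2) x' (Real.pi / 2))).2],
      (hmin _).trans_lt h2⟩

/-- The action over one period on the vectors `(y, z / N)`. -/
theorem isPolarAction (lam : ℝ) : IsPolarAction
    (polarSol N Q lam (Real.pi / 2) a) (polarSol N Q lam 0 a)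
    (polarQuasi N Q lam (Real.pi / 2) a / N) (polarQuasi N Q lam 0 a / N)
    (fun x => radius N Q lam x a) (rotation N Q a lam) where
  det := by
    have h1 := (isQuasiSolution_polar h.scale_pos h.continuous h.bound lam
      (Real.pi / 2)).wronskian_eq (isQuasiSolution_polar h.scale_pos h.continuous h.bound lam 0) a
    simp only [polarSol_zero h.scale_pos h.continuous h.bound,
      polarQuasi_zero h.scale_pos h.continuous h.bound, Real.sin_zero, Real.cos_zero,
      Real.sin_pi_div_two, Real.cos_pi_div_two] at h1
    have h2 : polarSol N Q lam (Real.pi / 2) a * polarQuasi N Q lam 0 a -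
        polarQuasi N Q lam (Real.pi / 2) a * polarSol N Q lam 0 a = N := by
      have : ((polarSol N Q lam (Real.pi / 2) a * polarQuasi N Q lam 0 a -
        polarQuasi N Q lam (Real.pi / 2) a * polarSol N Q lam 0 a : ℝ) : ℂ) = (N : ℝ) := by
        push_cast
        rw [h1]
        simp
      exact_mod_cast this
    have := h.scale_pos.ne'
    field_simp
    linarith
  pos x := radius_pos lam x a
  sin_eq x := by
    have h1 := ((isQuasiSolution_polar h.scale_pos h.continuous h.bound lam x).eq_comb
      h.scale_pos h.continuous h.bound a).1
    rw [polarSol_zero h.scale_pos h.continuous h.bound,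
      polarQuasi_zero h.scale_pos h.continuous h.bound] at h1
    have h2 : polarSol N Q lam x a = Real.sin x * polarSol N Q lam (Real.pi / 2) a +
        N * Real.cos x / N * polarSol N Q lam 0 a := by exact_mod_cast h1
    rw [mul_div_cancel_left₀ _ h.scale_pos.ne'] at h2
    rw [rotation, add_sub_cancel, ← polarSol, h2]
    ring
  cos_eq x := by
    have h1 := ((isQuasiSolution_polar h.scale_pos h.continuous h.bound lam x).eq_comb
      h.scale_pos h.continuous h.bound a).2
    rw [polarSol_zero h.scale_pos h.continuous h.bound,
      polarQuasi_zero h.scale_pos h.continuous h.bound] at h1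
    have h2 : polarQuasi N Q lam x a = Real.sin x * polarQuasi N Q lam (Real.pi / 2) a +
        N * Real.cos x / N * polarQuasi N Q lam 0 a := by exact_mod_cast h1
    rw [mul_div_cancel_left₀ _ h.scale_pos.ne', polarQuasi] at h2
    have hN := h.scale_pos.ne'
    rw [rotation, add_sub_cancel]
    field_simp
    linarith
  osc x x' := h.abs_rotation_sub_lt lam x x'

theorem isQuasiSolution_solutionMap (lam : ℝ) (v : ℂ × ℂ) :
    IsQuasiSolution Q lam (solutionMap N Q lam v) (fun t =>
      v.1 * polarQuasi N Q lam (Real.pi / 2) t + v.2 * polarQuasi N Q lam 0 t) :=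
  ((isQuasiSolution_polar h.scale_pos h.continuous h.bound lam (Real.pi / 2)).const_mul v.1).add
    ((isQuasiSolution_polar h.scale_pos h.continuous h.bound lam 0).const_mul v.2)

theorem solutionMap_zero (lam : ℝ) (v : ℂ × ℂ) : solutionMap N Q lam v 0 = v.1 := by
  simp [solutionMap, polarSol_zero h.scale_pos h.continuous h.bound]

theorem deriv_solutionMap_zero (lam : ℝ) (v : ℂ × ℂ) :
    deriv (solutionMap N Q lam v) 0 = N * v.2 := by
  rw [((h.isQuasiSolution_solutionMap lam v).1 0).deriv, h.primitive_zero]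
  simp [polarQuasi_zero h.scale_pos h.continuous h.bound, mul_comm]

theorem solutionMap_injective (lam : ℝ) : Function.Injective (solutionMap N Q lam) := by
  intro v w hvw
  have h1 := h.solutionMap_zero lam v
  have h2 := h.deriv_solutionMap_zero lam v
  rw [hvw] at h1 h2
  rw [h.solutionMap_zero] at h1
  rw [h.deriv_solutionMap_zero] at h2
  exact Prod.ext h1.symm
    (mul_left_cancel₀ (Complex.ofReal_ne_zero.2 h.scale_pos.ne') h2).symm

/-- Initial data give an isomorphism between the fixed vectors of `σ⁻¹ M`, where `M` is the matrix
of the action over one period, and the solutions with the boundary conditions of `eigenspace`. As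
`Q` vanishes at both ends, the conditions on `y'` and on the quasi-derivative coincide there. -/
theorem map_fixedSpace (lam σ : ℝ) :
    (fixedSpace (polarSol N Q lam (Real.pi / 2) a) (polarSol N Q lam 0 a)
      (polarQuasi N Q lam (Real.pi / 2) a / N) (polarQuasi N Q lam 0 a / N) σ).map
      (solutionMap N Q lam) = eigenspace a q σ lam := by
  have hN : (N : ℂ) ≠ 0 := Complex.ofReal_ne_zero.2 h.scale_pos.ne'
  have hend : ∀ v : ℂ × ℂ, solutionMap N Q lam v a =
      polarSol N Q lam (Real.pi / 2) a * v.1 + polarSol N Q lam 0 a * v.2 ∧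
      deriv (solutionMap N Q lam v) a = N * (((polarQuasi N Q lam (Real.pi / 2) a / N : ℝ) : ℂ) *
        v.1 + ((polarQuasi N Q lam 0 a / N : ℝ) : ℂ) * v.2) := by
    intro v
    constructor
    · simp only [solutionMap, LinearMap.coe_mk, AddHom.coe_mk]
      ring
    · rw [((h.isQuasiSolution_solutionMap lam v).1 a).deriv, h.eq_zero]
      push_cast
      field_simp
      ring
  ext y
  constructor
  · rintro ⟨v, ⟨h1, h2⟩, rfl⟩
    refine ⟨(h.isQuasiSolution_solutionMap lam v).isSolution h.isPrimitive, ?_, ?_⟩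
    · rw [(hend v).1, h1, h.solutionMap_zero]
    · rw [(hend v).2, h2, h.deriv_solutionMap_zero]
      ring
  · rintro ⟨h1, h2, h3⟩
    have hy : y = solutionMap N Q lam (y 0, deriv y 0 / N) := by
      funext t
      have := ((h1.isQuasiSolution h.isPrimitive).eq_comb h.scale_pos h.continuous h.bound t).1
      rw [this]
      simp [solutionMap, h.primitive_zero]
    have h4 := hend (y 0, deriv y 0 / N)
    rw [← hy, h2, h3] at h4
    refine ⟨(y 0, deriv y 0 / N), ⟨h4.1.symm, ?_⟩, hy.symm⟩
    refine mul_left_cancel₀ hN (h4.2.symm.trans ?_)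
    field_simp

open Classical in
/-- The multiplicity of an eigenvalue is the number of extremal rotations that are multiples of `π`
of the parity given by `σ`. -/
theorem finrank_eigenspace (lam : ℝ) {σ : ℝ} (hσ : σ ^ 2 = 1) :
    Module.finrank ℂ (eigenspace a q σ lam) =
      (if Real.cos (maxRotation N Q a lam) = σ then 1 else 0) +
        if Real.cos (minRotation N Q a lam) = σ then 1 else 0 := by
  obtain ⟨xU, hU, hUm⟩ := h.exists_maxRotation lam
  obtain ⟨xL, hL, hLm⟩ := h.exists_minRotation lam
  rw [hU, hL, ← (h.isPolarAction lam).finrank_fixedSpace hσ hUm hLm, ← h.map_fixedSpace lam σ]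
  exact (Submodule.equivMapOfInjective _ (h.solutionMap_injective lam) _).finrank_eq.symm

/-- The lower edge of the `n`-th instability interval is where the largest rotation equals
`n π`. -/
theorem eigenvalue_eq_of_maxRotation {n : ℕ} (hn : 1 ≤ n) {lam : ℝ}
    (hlam : maxRotation N Q a lam = n * Real.pi) :
    eigenvalue a q ((-1) ^ n) (n - 1) = lam := by
  have hmult := fun l => h.finrank_eigenspace l (σ := (-1) ^ n) (by rw [← pow_mul, mul_comm]; simp)
  have hc : ((-1 : ℂ)) ^ n = (((-1 : ℝ) ^ n : ℝ) : ℂ) := by push_cast; rfl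
  rw [hc]
  exact (h.isRotationPair.isLeast_max hmult hn hlam).csInf_eq

/-- The upper edge of the `n`-th instability interval is where the smallest rotation equals
`n π`. -/
theorem eigenvalue_eq_of_minRotation {n : ℕ} (hn : 1 ≤ n) {lam : ℝ}
    (hlam : minRotation N Q a lam = n * Real.pi) :
    eigenvalue a q ((-1) ^ n) n = lam := by
  have hmult := fun l => h.finrank_eigenspace l (σ := (-1) ^ n) (by rw [← pow_mul, mul_comm]; simp)
  have hc : ((-1 : ℂ)) ^ n = (((-1 : ℝ) ^ n : ℝ) : ℂ) := by push_cast; rfl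
  rw [hc]
  exact (h.isRotationPair.isLeast_min hmult hn hlam).csInf_eq

end IsHillData

/-! ### Absolutely continuous functions -/

/-- A continuously differentiable function is Lipschitz on a ball that contains the range of `f`. -/
theorem _root_.AbsolutelyContinuousOnInterval.contDiff_comp {E F : Type*} [NormedAddCommGroup E]
    [NormedSpace ℝ E] [ProperSpace E] [NormedAddCommGroup F] [NormedSpace ℝ F] {f : ℝ → E}
    {g : E → F} {s t : ℝ} (hf : AbsolutelyContinuousOnInterval f s t) (hg : ContDiff ℝ 1 g) :
    AbsolutelyContinuousOnInterval (fun x => g (f x)) s t := by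
  obtain ⟨C, hC⟩ := hf.exists_bound
  obtain ⟨K, hK⟩ := hg.contDiffOn.exists_lipschitzOnWith (by decide)
    (convex_closedBall (0 : E) C) (isCompact_closedBall 0 C)
  rw [absolutelyContinuousOnInterval_iff] at hf ⊢
  intro ε hε
  obtain ⟨δ, hδ, h⟩ := hf (ε / (K + 1)) (by positivity)
  refine ⟨δ, hδ, fun I hI hlen => ?_⟩
  have hmem : ∀ x ∈ Set.uIcc s t, f x ∈ Metric.closedBall (0 : E) C := fun x hx => by
    simpa using hC x hx
  calc ∑ i ∈ Finset.range I.1, dist (g (f (I.2 i).1)) (g (f (I.2 i).2))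
      ≤ ∑ i ∈ Finset.range I.1, K * dist (f (I.2 i).1) (f (I.2 i).2) :=
        Finset.sum_le_sum fun i hi =>
          hK.dist_le_mul _ (hmem _ (hI.1 i hi).1) _ (hmem _ (hI.1 i hi).2)
    _ = K * ∑ i ∈ Finset.range I.1, dist (f (I.2 i).1) (f (I.2 i).2) :=
        (Finset.mul_sum _ _ _).symm
    _ ≤ K * (ε / (K + 1)) := by gcongr; exact (h I hI hlen).le
    _ < (K + 1) * (ε / (K + 1)) := by gcongr; linarith
    _ = ε := by field_simp

theorem integral_eq_sub_of_ae_hasDerivAt {f g : ℝ → ℝ} {s t : ℝ}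
    (hf : AbsolutelyContinuousOnInterval f s t) (hfg : ∀ᵐ x, HasDerivAt f (g x) x) :
    ∫ x in s..t, g x = f t - f s := by
  rw [← hf.integral_deriv_eq_sub]
  refine intervalIntegral.integral_congr_ae ?_
  filter_upwards [hfg] with x hx _ using hx.deriv.symm

/-! ### The classical Prüfer angle -/

/-- The complex number `(y' + i N y) / (N r)` for `y = r sin θ` and `y' - Q y = N r cos θ`, where
`(r, θ)` are the regularised Prüfer variables, as a function of `ζ = θ + i Q`. -/
def shear (N : ℝ) (ζ : ℂ) : ℂ :=
  ((Real.cos ζ.re + ζ.im * N⁻¹ * Real.sin ζ.re : ℝ) : ℂ) + (Real.sin ζ.re : ℂ) * Complex.I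

/-- The classical Prüfer angle `arg (y' + i N y)` as a function of `ζ = θ + i Q`, where `θ` is the
regularised angle. The shear that takes `N⁻¹ (y' - Q y)` to `N⁻¹ y'` turns no vector by `π`, so
the correction to `θ` is a principal value. -/
def unshearedAngle (N : ℝ) (ζ : ℂ) : ℝ :=
  ζ.re + (Complex.log (shear N ζ * Complex.exp (-(ζ.re : ℂ) * Complex.I))).im

theorem shear_mul_exp (N : ℝ) (ζ : ℂ) : shear N ζ * Complex.exp (-(ζ.re : ℂ) * Complex.I) =
    ⟨1 + ζ.im * N⁻¹ * (Real.sin ζ.re * Real.cos ζ.re), -(ζ.im * N⁻¹ * Real.sin ζ.re ^ 2)⟩ := by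
  have h1 : Complex.exp (-(ζ.re : ℂ) * Complex.I) = ⟨Real.cos ζ.re, -Real.sin ζ.re⟩ := by
    rw [← Complex.ofReal_neg]
    exact Complex.ext (by rw [Complex.exp_ofReal_mul_I_re, Real.cos_neg])
      (by rw [Complex.exp_ofReal_mul_I_im, Real.sin_neg])
  have h2 : shear N ζ = ⟨Real.cos ζ.re + ζ.im * N⁻¹ * Real.sin ζ.re, Real.sin ζ.re⟩ := by
    rw [shear, Complex.mk_eq_add_mul_I]
  have h3 := Real.sin_sq_add_cos_sq ζ.re
  rw [h1, h2]
  apply Complex.ext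
  · simp only [Complex.mul_re]
    linear_combination h3
  · simp only [Complex.mul_im]
    ring

theorem shear_mul_exp_mem_slitPlane (N : ℝ) (ζ : ℂ) :
    shear N ζ * Complex.exp (-(ζ.re : ℂ) * Complex.I) ∈ Complex.slitPlane := by
  rw [shear_mul_exp, Complex.mem_slitPlane_iff]
  by_cases h : ζ.im * N⁻¹ * Real.sin ζ.re ^ 2 = 0
  · left
    have h' : ζ.im * N⁻¹ * Real.sin ζ.re = 0 := by
      rcases mul_eq_zero.1 h with h | h
      · rw [h, zero_mul]
      · rw [pow_eq_zero_iff two_ne_zero |>.1 h, mul_zero]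
    simp only
    rw [← mul_assoc, h']
    norm_num
  · right
    simpa using h

theorem shear_ne_zero (N : ℝ) (ζ : ℂ) : shear N ζ ≠ 0 :=
  left_ne_zero_of_mul (Complex.slitPlane_ne_zero (shear_mul_exp_mem_slitPlane N ζ))

theorem contDiff_shear (N : ℝ) : ContDiff ℝ 1 (shear N) := by
  have h1 : ContDiff ℝ 1 (fun ζ : ℂ => ζ.re) := Complex.reCLM.contDiff
  have h2 : ContDiff ℝ 1 (fun ζ : ℂ => ζ.im) := Complex.imCLM.contDiff
  have h3 := (Real.contDiff_cos.comp h1).add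
    ((h2.mul (contDiff_const (c := N⁻¹))).mul (Real.contDiff_sin.comp h1))
  exact (Complex.ofRealCLM.contDiff.comp h3).add
    ((Complex.ofRealCLM.contDiff.comp (Real.contDiff_sin.comp h1)).mul contDiff_const)

theorem contDiff_unshearedAngle (N : ℝ) : ContDiff ℝ 1 (unshearedAngle N) := by
  have h1 : ContDiff ℝ 1 (fun ζ : ℂ => ζ.re) := Complex.reCLM.contDiff
  have h2 : ContDiff ℝ 1 fun ζ : ℂ => shear N ζ * Complex.exp (-(ζ.re : ℂ) * Complex.I) :=
    (contDiff_shear N).mul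
      ((((Complex.ofRealCLM.contDiff.comp h1).neg).mul contDiff_const).cexp)
  have h3 : ContDiff ℝ 1 fun ζ : ℂ =>
      Complex.log (shear N ζ * Complex.exp (-(ζ.re : ℂ) * Complex.I)) :=
    contDiff_iff_contDiffAt.2 fun ζ => ContDiffAt.comp (g := Complex.log) ζ
      ((Complex.contDiffAt_log (shear_mul_exp_mem_slitPlane N ζ)).restrict_scalars ℝ)
      h2.contDiffAt
  exact h1.add (Complex.imCLM.contDiff.comp h3)

theorem unshearedAngle_of_im_eq_zero {N : ℝ} {ζ : ℂ} (h : ζ.im = 0) :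
    unshearedAngle N ζ = ζ.re := by
  rw [unshearedAngle, shear_mul_exp, h]
  have : (⟨1 + 0 * N⁻¹ * (Real.sin ζ.re * Real.cos ζ.re), -(0 * N⁻¹ * Real.sin ζ.re ^ 2)⟩ : ℂ) = 1 := by
    apply Complex.ext <;> simp
  rw [this]
  simp

theorem sin_unshearedAngle (N : ℝ) (ζ : ℂ) :
    ‖shear N ζ‖ * Real.sin (unshearedAngle N ζ) = Real.sin ζ.re := by
  set w := shear N ζ * Complex.exp (-(ζ.re : ℂ) * Complex.I) with hw
  have hnorm : ‖w‖ = ‖shear N ζ‖ := by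
    rw [hw, norm_mul, ← Complex.ofReal_neg, Complex.norm_exp_ofReal_mul_I, mul_one]
  have h1 : shear N ζ = ‖shear N ζ‖ * Complex.exp ((unshearedAngle N ζ : ℂ) * Complex.I) := by
    have h2 := Complex.norm_mul_exp_arg_mul_I w
    rw [hnorm] at h2
    rw [unshearedAngle, Complex.log_im, ← hw]
    push_cast
    rw [add_mul, Complex.exp_add, mul_left_comm, h2, hw, mul_left_comm, ← Complex.exp_add]
    simp
  have h3 := congrArg Complex.im h1
  rw [Complex.im_ofReal_mul, Complex.exp_ofReal_mul_I_im] at h3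
  rw [← h3, shear, Complex.add_im, Complex.ofReal_im, Complex.im_ofReal_mul, Complex.I_im, zero_add,
    mul_one]

/-- The classical Prüfer angle of the solution with angle `x` at time `0`. -/
def pruferAngle (N : ℝ) (Q : ℝ → ℝ) (lam x t : ℝ) : ℝ :=
  unshearedAngle N (angle N Q lam x t + Q t * Complex.I)

namespace IsHillData

variable {a N B : ℝ} {q Q : ℝ → ℝ} (h : IsHillData a N B q Q)
include h

theorem pruferAngle_zero (lam x : ℝ) : pruferAngle N Q lam x 0 = x := by
  rw [pruferAngle, unshearedAngle_of_im_eq_zero (by simp [h.primitive_zero])]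
  simp [angle_zero h.scale_pos h.continuous h.bound]

/-- The two Prüfer angles agree after one period because `Q` vanishes there. -/
theorem pruferAngle_period (lam x : ℝ) : pruferAngle N Q lam x a = angle N Q lam x a := by
  rw [pruferAngle, unshearedAngle_of_im_eq_zero (by simp [h.eq_zero])]
  simp

theorem absolutelyContinuous_pruferAngle (lam x s t : ℝ) :
    AbsolutelyContinuousOnInterval (pruferAngle N Q lam x) s t := by
  have hd := hasDerivAt_angle h.scale_pos h.continuous h.bound lam x
  have hc : Continuous fun t => angleField N Q lam t (angle N Q lam x t) := by
    have h1 := continuous_angle h.scale_pos h.continuous h.bound lam x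
    have h2 := h.continuous
    unfold angleField
    fun_prop
  have hderiv : deriv (angle N Q lam x) = fun t => angleField N Q lam t (angle N Q lam x t) :=
    funext fun t => (hd t).deriv
  have hθ : ContDiff ℝ 1 (angle N Q lam x) := contDiff_one_iff_deriv.2
    ⟨fun t => (hd t).differentiableAt, hderiv ▸ hc⟩
  have h1 : AbsolutelyContinuousOnInterval (fun t => (angle N Q lam x t : ℂ)) s t :=
    hθ.contDiffOn.absolutelyContinuousOnInterval.contDiff_comp Complex.ofRealCLM.contDiff
  have h2 : AbsolutelyContinuousOnInterval (fun _ : ℝ => Complex.I) s t :=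
    (contDiff_const (n := 1)).contDiffOn.absolutelyContinuousOnInterval
  have h4 : AbsolutelyContinuousOnInterval (fun t => Q t • Complex.I) s t :=
    (h.isPrimitive.absolutelyContinuous s t).fun_smul h2
  have h3 : AbsolutelyContinuousOnInterval
      (fun t => (angle N Q lam x t : ℂ) + Q t * Complex.I) s t := by
    simpa only [Complex.real_smul] using h1.fun_add h4
  exact h3.contDiff_comp (contDiff_unshearedAngle N)

theorem continuous_pruferAngle (lam x : ℝ) : Continuous (pruferAngle N Q lam x) := by
  have h1 := continuous_angle h.scale_pos h.continuous h.bound lam x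
  have h2 := h.continuous
  have h3 : Continuous fun t => (angle N Q lam x t : ℂ) + Q t * Complex.I := by fun_prop
  exact (contDiff_unshearedAngle N).continuous.comp h3

/-- The classical equation for the Prüfer angle with scale `N`. -/
theorem ae_hasDerivAt_pruferAngle (lam x : ℝ) : ∀ᵐ t, HasDerivAt (pruferAngle N Q lam x)
    (N + N⁻¹ * (lam - N ^ 2 - q t) * Real.sin (pruferAngle N Q lam x t) ^ 2) t := by
  filter_upwards [h.isPrimitive.ae_hasDerivAt] with t hq
  have hθ := hasDerivAt_angle h.scale_pos h.continuous h.bound lam x t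
  set θ' := angleField N Q lam t (angle N Q lam x t) with hθ'
  have hNpos := h.scale_pos
  set ζ : ℂ := angle N Q lam x t + Q t * Complex.I with hζ
  have hre : ∀ s, ((angle N Q lam x s : ℂ) + Q s * Complex.I).re = angle N Q lam x s := by simp
  have him : ∀ s, ((angle N Q lam x s : ℂ) + Q s * Complex.I).im = Q s := by simp
  set c := Real.cos (angle N Q lam x t) with hc
  set s := Real.sin (angle N Q lam x t) with hs
  have hsc : s ^ 2 + c ^ 2 = 1 := Real.sin_sq_add_cos_sq _
  -- the derivative `c₁' + i s₁'` of the sheared vector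
  set c₁' := -s * θ' + (q t * N⁻¹ * s + Q t * N⁻¹ * (c * θ')) with hc₁'
  have hv : HasDerivAt (fun r => shear N (angle N Q lam x r + Q r * Complex.I))
      ((c₁' : ℂ) + ((c * θ' : ℝ) : ℂ) * Complex.I) t := by
    simp only [shear, hre, him]
    exact (hθ.cos.add ((hq.mul_const N⁻¹).mul hθ.sin)).ofReal_comp.add
      (hθ.sin.ofReal_comp.mul_const _)
  have hexp : HasDerivAt (fun r => Complex.exp (-(angle N Q lam x r : ℂ) * Complex.I))
      (Complex.exp (-(angle N Q lam x t : ℂ) * Complex.I) * (-(θ' : ℂ) * Complex.I)) t :=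
    ((hθ.ofReal_comp.neg).mul_const Complex.I).cexp
  have hw := hv.mul hexp
  have hmem := shear_mul_exp_mem_slitPlane N ζ
  have hv0 := shear_ne_zero N ζ
  have hreζ : ζ.re = angle N Q lam x t := hre t
  rw [hreζ] at hmem
  have hlog := hw.clog_real hmem
  have hT := hθ.add (Complex.imCLM.hasFDerivAt.comp_hasDerivAt t hlog)
  have hfun : pruferAngle N Q lam x = (angle N Q lam x) + (Complex.imCLM ∘ fun r => Complex.log
      (((fun r => shear N (angle N Q lam x r + Q r * Complex.I)) *
        fun r => Complex.exp (-(angle N Q lam x r : ℂ) * Complex.I)) r)) := by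
    funext r
    simp [pruferAngle, unshearedAngle]
  rw [hfun]
  refine hT.congr_deriv ?_
  rw [← hfun]
  have hE := Complex.exp_ne_zero (-(angle N Q lam x t : ℂ) * Complex.I)
  have hquot : (((c₁' : ℂ) + ((c * θ' : ℝ) : ℂ) * Complex.I) *
      Complex.exp (-(angle N Q lam x t : ℂ) * Complex.I) + shear N ζ *
      (Complex.exp (-(angle N Q lam x t : ℂ) * Complex.I) * (-(θ' : ℂ) * Complex.I))) /
      (shear N ζ * Complex.exp (-(angle N Q lam x t : ℂ) * Complex.I)) =
      ((c₁' : ℂ) + ((c * θ' : ℝ) : ℂ) * Complex.I) / shear N ζ - (θ' : ℂ) * Complex.I := by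
    field_simp
    ring
  have hshear : shear N ζ = ⟨c + Q t * N⁻¹ * s, s⟩ := by
    rw [shear, hreζ, him t, Complex.mk_eq_add_mul_I]
  have hnsq : Complex.normSq (shear N ζ) = (c + Q t * N⁻¹ * s) ^ 2 + s ^ 2 := by
    rw [hshear, Complex.normSq_mk]; ring
  have hnpos : 0 < (c + Q t * N⁻¹ * s) ^ 2 + s ^ 2 := by
    rw [← hnsq]; exact Complex.normSq_pos.2 hv0
  have hsin : Real.sin (pruferAngle N Q lam x t) ^ 2 * ((c + Q t * N⁻¹ * s) ^ 2 + s ^ 2) =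
      s ^ 2 := by
    have h1 := sin_unshearedAngle N ζ
    rw [hreζ, ← hs] at h1
    rw [← hnsq, Complex.normSq_eq_norm_sq, ← mul_pow, mul_comm (Real.sin _), pruferAngle, h1]
  have hgoal : θ' + ((((c₁' : ℂ) + ((c * θ' : ℝ) : ℂ) * Complex.I) / shear N ζ) -
      (θ' : ℂ) * Complex.I).im = N + N⁻¹ * (lam - N ^ 2 - q t) *
      Real.sin (pruferAngle N Q lam x t) ^ 2 := by
    rw [Complex.sub_im, Complex.div_im, hnsq, hshear]
    simp only [Complex.add_im, Complex.add_re, Complex.mul_im, Complex.mul_re, Complex.ofReal_re,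
      Complex.ofReal_im, Complex.I_re, Complex.I_im, mul_zero, mul_one, zero_add, add_zero,
      sub_zero]
    set c₁ := c + Q t * N⁻¹ * s with hc₁
    have hk : N * N⁻¹ = 1 := mul_inv_cancel₀ hNpos.ne'
    have hθ'' : θ' = N * c₁ ^ 2 + N⁻¹ * lam * s ^ 2 := by
      rw [hθ', angleField, ← hc, ← hs, hc₁]
      field_simp
    have hnum : c * θ' * c₁ - c₁' * s = N * c₁ ^ 2 + N⁻¹ * (lam - q t) * s ^ 2 := by
      rw [hc₁, hc₁']
      linear_combination θ' * hsc + hθ''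
    rw [eq_div_of_mul_eq hnpos.ne' hsin]
    have hL : θ' + (c * θ' * c₁ / (c₁ ^ 2 + s ^ 2) - c₁' * s / (c₁ ^ 2 + s ^ 2) - θ') =
        (c * θ' * c₁ - c₁' * s) / (c₁ ^ 2 + s ^ 2) := by ring
    rw [hL, hnum, div_eq_iff hnpos.ne', add_mul, mul_assoc _ (s ^ 2 / _),
      div_mul_cancel₀ _ hnpos.ne']
    linear_combination (N * s ^ 2) * hk
  rw [← hgoal]
  simp only [Complex.imCLM_apply]
  congr 2

end IsHillData

/-! ### Asymptotics of the rotation -/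

/-- Integration by parts for `∫ p cos 2T` when `T` has derivative `N` up to an integrable error
`k`: with `ψ = T - N t`, the integrand differs from the derivative of
`G_c cos 2ψ - G_s sin 2ψ` by `2 ψ' (G_c sin 2ψ + G_s cos 2ψ)`. -/
theorem abs_integral_mul_cos_sub_le {p Gc Gs T k g : ℝ → ℝ} {N M b : ℝ} (hb : 0 ≤ b)
    (hp : IntervalIntegrable p volume 0 b)
    (hGc : IsPrimitive (fun t => p t * Real.cos (2 * N * t)) Gc)
    (hGs : IsPrimitive (fun t => p t * Real.sin (2 * N * t)) Gs)
    (hT : AbsolutelyContinuousOnInterval T 0 b) (hTc : Continuous T)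
    (hTd : ∀ᵐ t, HasDerivAt T (N + g t) t) (hg : ∀ t, |g t| ≤ k t)
    (hk : IntervalIntegrable k volume 0 b)
    (hM : 0 ≤ M) (hG : ∀ t ∈ Set.Icc 0 b, Gc t ^ 2 + Gs t ^ 2 ≤ M ^ 2) :
    |(Gc b * Real.cos (2 * (T b - N * b)) - Gs b * Real.sin (2 * (T b - N * b))) -
      ∫ t in (0 : ℝ)..b, p t * Real.cos (2 * T t)| ≤ 2 * M * ∫ t in (0 : ℝ)..b, k t := by
  set ψ : ℝ → ℝ := fun t => 2 * (T t - N * t) with hψ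
  set H : ℝ → ℝ := fun t => Gc t * Real.cos (ψ t) - Gs t * Real.sin (ψ t) with hH
  have hψac : AbsolutelyContinuousOnInterval ψ 0 b := by
    have h1 : AbsolutelyContinuousOnInterval (fun t : ℝ => N * t) 0 b :=
      (contDiff_const.mul contDiff_id :
        ContDiff ℝ 1 fun t : ℝ => N * t).contDiffOn.absolutelyContinuousOnInterval
    exact (hT.fun_sub h1).const_mul 2
  have hHac : AbsolutelyContinuousOnInterval H 0 b :=
    ((hGc.absolutelyContinuous 0 b).fun_mul (hψac.contDiff_comp Real.contDiff_cos)).fun_sub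
      ((hGs.absolutelyContinuous 0 b).fun_mul (hψac.contDiff_comp Real.contDiff_sin))
  have hHd : ∀ᵐ t, HasDerivAt H (p t * Real.cos (2 * T t) -
      2 * g t * (Gc t * Real.sin (ψ t) + Gs t * Real.cos (ψ t))) t := by
    filter_upwards [hGc.ae_hasDerivAt, hGs.ae_hasDerivAt, hTd] with t h1 h2 h3
    have h4 : HasDerivAt ψ (2 * g t) t :=
      ((h3.sub ((hasDerivAt_id t).const_mul N)).const_mul 2).congr_deriv (by ring)
    refine ((h1.mul h4.cos).sub (h2.mul h4.sin)).congr_deriv ?_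
    have h5 : 2 * T t = 2 * N * t + ψ t := by rw [hψ]; ring
    rw [h5, Real.cos_add]
    ring
  have hGc0 : Gc 0 = 0 := by rw [hGc.eq_integral]; simp
  have hGs0 : Gs 0 = 0 := by rw [hGs.eq_integral]; simp
  have hpc : IntervalIntegrable (fun t => p t * Real.cos (2 * T t)) volume 0 b :=
    hp.mul_continuousOn (by fun_prop)
  have hHb : H b = ∫ t in (0 : ℝ)..b, deriv H t := by
    rw [hHac.integral_deriv_eq_sub, hH]
    simp [hGc0, hGs0]
  change |H b - _| ≤ _
  rw [hHb, ← intervalIntegral.integral_sub hHac.intervalIntegrable_deriv hpc,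
    ← intervalIntegral.integral_const_mul, ← Real.norm_eq_abs]
  refine intervalIntegral.norm_integral_le_of_norm_le hb ?_ (hk.const_mul _)
  filter_upwards [hHd] with t ht hmem
  have hmem' : t ∈ Set.Icc 0 b := Set.Ioc_subset_Icc_self hmem
  rw [ht.deriv, sub_sub_cancel_left, norm_neg, Real.norm_eq_abs, abs_mul, abs_mul, abs_two]
  have h1 : |Gc t * Real.sin (ψ t) + Gs t * Real.cos (ψ t)| ≤ M := by
    refine abs_le_of_sq_le_sq ?_ hM
    have h2 := Real.sin_sq_add_cos_sq (ψ t)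
    have h3 : (Gc t * Real.sin (ψ t) + Gs t * Real.cos (ψ t)) ^ 2 =
        Gc t ^ 2 + Gs t ^ 2 - (Gc t * Real.cos (ψ t) - Gs t * Real.sin (ψ t)) ^ 2 := by
      linear_combination (Gc t ^ 2 + Gs t ^ 2) * h2
    linarith [hG t hmem', sq_nonneg (Gc t * Real.cos (ψ t) - Gs t * Real.sin (ψ t))]
  have h2 := mul_le_mul (hg t) h1 (abs_nonneg _) ((abs_nonneg _).trans (hg t))
  linarith

/-- A trigonometric form of amplitude `W`. -/
theorem exists_amplitude {A S W : ℝ} (hW : 0 ≤ W) (h : A ^ 2 + S ^ 2 = W ^ 2) :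
    ∃ β : ℝ, ∀ Φ, A * Real.cos (2 * Φ) - S * Real.sin (2 * Φ) = W * Real.cos (2 * Φ + β) := by
  have hn : ‖(⟨A, S⟩ : ℂ)‖ = W := by
    refine (sq_eq_sq₀ (norm_nonneg _) hW).1 ?_
    rw [← Complex.normSq_eq_norm_sq, Complex.normSq_mk, ← h]
    ring
  refine ⟨Complex.arg ⟨A, S⟩, fun Φ => ?_⟩
  have h1 := Complex.norm_mul_cos_arg ⟨A, S⟩
  have h2 := Complex.norm_mul_sin_arg ⟨A, S⟩
  rw [hn] at h1 h2
  simp only at h1 h2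
  rw [Real.cos_add]
  linear_combination (-Real.cos (2 * Φ)) * h1 + Real.sin (2 * Φ) * h2

theorem isPrimitive_integral {p : ℝ → ℝ} (hp : ∀ s t, IntervalIntegrable p volume s t) :
    IsPrimitive p fun t => ∫ s in (0 : ℝ)..t, p s := ⟨hp, fun _ => rfl⟩

namespace IsHillData

variable {a N B : ℝ} {q Q : ℝ → ℝ} (h : IsHillData a N B q Q)
include h

theorem isPrimitive_cos : IsPrimitive (fun t => q t * Real.cos (2 * N * t))
    fun t => ∫ s in (0 : ℝ)..t, q s * Real.cos (2 * N * s) :=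
  isPrimitive_integral fun s t =>
    (h.isPrimitive.intervalIntegrable s t).mul_continuousOn (by fun_prop)

theorem isPrimitive_sin : IsPrimitive (fun t => q t * Real.sin (2 * N * t))
    fun t => ∫ s in (0 : ℝ)..t, q s * Real.sin (2 * N * s) :=
  isPrimitive_integral fun s t =>
    (h.isPrimitive.intervalIntegrable s t).mul_continuousOn (by fun_prop)

/-- The equation for the classical Prüfer angle integrated over one period, with
`sin² = (1 - cos 2T) / 2` and `∫ q = 0`. -/
theorem rotation_eq {n : ℕ} (hNa : N * a = n * Real.pi) (lam x : ℝ) :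
    2 * N * (rotation N Q a lam x - n * Real.pi) = (lam - N ^ 2) * a -
      (lam - N ^ 2) * (∫ t in (0 : ℝ)..a, 1 * Real.cos (2 * pruferAngle N Q lam x t)) +
      ∫ t in (0 : ℝ)..a, q t * Real.cos (2 * pruferAngle N Q lam x t) := by
  have hc := h.continuous_pruferAngle lam x
  have hN := h.scale_pos.ne'
  have hq := h.isPrimitive.intervalIntegrable 0 a
  have h1 := integral_eq_sub_of_ae_hasDerivAt (h.absolutelyContinuous_pruferAngle lam x 0 a)
    (h.ae_hasDerivAt_pruferAngle lam x)
  rw [h.pruferAngle_zero, h.pruferAngle_period] at h1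
  have h2 : ∀ t, N + N⁻¹ * (lam - N ^ 2 - q t) * Real.sin (pruferAngle N Q lam x t) ^ 2 =
      (N + (2 * N)⁻¹ * (lam - N ^ 2)) -
        (2 * N)⁻¹ * (lam - N ^ 2) * (1 * Real.cos (2 * pruferAngle N Q lam x t)) -
        (2 * N)⁻¹ * q t + (2 * N)⁻¹ * (q t * Real.cos (2 * pruferAngle N Q lam x t)) := by
    intro t
    rw [Real.sin_sq_eq_half_sub]
    field_simp
    ring
  simp only [h2] at h1
  have hq0 : ∫ t in (0 : ℝ)..a, q t = 0 := by rw [← h.isPrimitive.eq_integral, h.eq_zero]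
  have hcos : IntervalIntegrable (fun t => 1 * Real.cos (2 * pruferAngle N Q lam x t))
      volume 0 a := Continuous.intervalIntegrable (by fun_prop) _ _
  have hqcos : IntervalIntegrable (fun t => q t * Real.cos (2 * pruferAngle N Q lam x t))
      volume 0 a := hq.mul_continuousOn (by fun_prop)
  rw [intervalIntegral.integral_add, intervalIntegral.integral_sub, intervalIntegral.integral_sub,
    intervalIntegral.integral_const,
    intervalIntegral.integral_const_mul ((2 * N)⁻¹ * (lam - N ^ 2)),
    intervalIntegral.integral_const_mul (2 * N)⁻¹ q,
    intervalIntegral.integral_const_mul (2 * N)⁻¹ fun t => q t * Real.cos _, hq0] at h1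
  · rw [rotation, ← h1, ← hNa, smul_eq_mul]
    field_simp
    ring
  · exact intervalIntegrable_const
  · exact hcos.const_mul _
  · exact intervalIntegrable_const.sub (hcos.const_mul _)
  · exact hq.const_mul _
  · exact (intervalIntegrable_const.sub (hcos.const_mul _)).sub (hq.const_mul _)
  · exact hqcos.const_mul _

/-- The rotation at scale `N = n π / a` up to an error controlled by the partial Fourier
integrals of `q`. -/
theorem abs_rotation_sub_le {n : ℕ} (hNa : N * a = n * Real.pi) {M : ℝ} (hM : 0 ≤ M)
    (hG : ∀ t ∈ Set.Icc 0 a, (∫ s in (0 : ℝ)..t, q s * Real.cos (2 * N * s)) ^ 2 +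
      (∫ s in (0 : ℝ)..t, q s * Real.sin (2 * N * s)) ^ 2 ≤ M ^ 2) (lam x : ℝ) :
    |2 * N * (rotation N Q a lam x - n * Real.pi) - (lam - N ^ 2) * a -
      ((∫ s in (0 : ℝ)..a, q s * Real.cos (2 * N * s)) * Real.cos (2 * angle N Q lam x a) -
        (∫ s in (0 : ℝ)..a, q s * Real.sin (2 * N * s)) * Real.sin (2 * angle N Q lam x a))| ≤
      2 * (M + |lam - N ^ 2| * N⁻¹) *
        (N⁻¹ * (|lam - N ^ 2| * a + ∫ t in (0 : ℝ)..a, |q t|)) := by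
  have hN := h.scale_pos
  have hc := h.continuous_pruferAngle lam x
  have hq := h.isPrimitive.intervalIntegrable 0 a
  set T := pruferAngle N Q lam x with hT
  set κ := lam - N ^ 2 with hκ
  set k : ℝ → ℝ := fun t => N⁻¹ * (|κ| + |q t|) with hkdef
  have hg : ∀ t, |N⁻¹ * (κ - q t) * Real.sin (T t) ^ 2| ≤ k t := by
    intro t
    rw [abs_mul, abs_mul, abs_of_pos (inv_pos.2 hN), abs_of_nonneg (sq_nonneg (Real.sin (T t)))]
    refine (mul_le_of_le_one_right (by positivity) (Real.sin_sq_le_one _)).trans ?_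
    exact mul_le_mul_of_nonneg_left (abs_sub _ _) (inv_pos.2 hN).le
  have hk : IntervalIntegrable k volume 0 a :=
    (intervalIntegrable_const.add hq.abs).const_mul _
  have hkint : ∫ t in (0 : ℝ)..a, k t = N⁻¹ * (|κ| * a + ∫ t in (0 : ℝ)..a, |q t|) := by
    rw [hkdef, intervalIntegral.integral_const_mul,
      intervalIntegral.integral_add intervalIntegrable_const hq.abs,
      intervalIntegral.integral_const, smul_eq_mul, sub_zero, mul_comm a]
  have hend : ∀ f : ℝ → ℝ, (∀ y, f (y - n * (2 * Real.pi)) = f y) →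
      f (2 * (T a - N * a)) = f (2 * angle N Q lam x a) := by
    intro f hf
    rw [← hf (2 * angle N Q lam x a), hT, h.pruferAngle_period, hNa]
    congr 1
    ring
  have hcosend := hend Real.cos fun y => Real.cos_sub_nat_mul_two_pi y n
  have hsinend := hend Real.sin fun y => Real.sin_sub_nat_mul_two_pi y n
  have hTd := h.ae_hasDerivAt_pruferAngle lam x
  have hTac := h.absolutelyContinuous_pruferAngle lam x 0 a
  have e1 := abs_integral_mul_cos_sub_le h.period_pos.le hq h.isPrimitive_cos h.isPrimitive_sin
    hTac hc hTd hg hk hM hG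
  -- the same with `q` replaced by `1`, whose partial Fourier integrals are at most `N⁻¹`
  have h1c : ∀ t, ∫ s in (0 : ℝ)..t, 1 * Real.cos (2 * N * s) =
      (2 * N)⁻¹ * Real.sin (2 * N * t) := by
    intro t
    simp only [one_mul]
    rw [intervalIntegral.integral_comp_mul_left (fun s => Real.cos s) (by positivity)]
    simp
  have h1s : ∀ t, ∫ s in (0 : ℝ)..t, 1 * Real.sin (2 * N * s) =
      (2 * N)⁻¹ * (1 - Real.cos (2 * N * t)) := by
    intro t
    simp only [one_mul]
    rw [intervalIntegral.integral_comp_mul_left (fun s => Real.sin s) (by positivity)]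
    simp
  have hone : ∀ f : ℝ → ℝ, Continuous f → IsPrimitive (fun t => 1 * f (2 * N * t))
      fun t => ∫ s in (0 : ℝ)..t, 1 * f (2 * N * s) := fun f hf =>
    isPrimitive_integral fun s t => Continuous.intervalIntegrable (by fun_prop) _ _
  have e2 := abs_integral_mul_cos_sub_le (p := fun _ => 1) h.period_pos.le
    intervalIntegrable_const (hone _ Real.continuous_cos) (hone _ Real.continuous_sin)
    hTac hc hTd hg hk (inv_pos.2 hN).le (fun t _ => by
      rw [h1c, h1s]
      have := Real.sin_sq_add_cos_sq (2 * N * t)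
      have hc1 := Real.neg_one_le_cos (2 * N * t)
      have hN2 : 0 < N⁻¹ ^ 2 := by positivity
      rw [mul_inv]
      nlinarith)
  have hNa2 : 2 * N * a = n * (2 * Real.pi) := by linear_combination 2 * hNa
  rw [h1c, h1s, hNa2, Real.cos_nat_mul_two_pi, sub_self, mul_zero, zero_mul, sub_zero] at e2
  have hs0 : Real.sin (n * (2 * Real.pi)) = 0 := by
    have := Real.sin_nat_mul_pi (2 * n)
    rw [← this]
    push_cast
    ring_nf
  rw [hs0, mul_zero, zero_mul, zero_sub, abs_neg] at e2
  rw [hcosend, hsinend] at e1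
  rw [h.rotation_eq hNa lam x, ← hT, ← hκ, ← hkint]
  set J := ∫ t in (0 : ℝ)..a, q t * Real.cos (2 * T t)
  set J₁ := ∫ t in (0 : ℝ)..a, 1 * Real.cos (2 * T t)
  set G := (∫ s in (0 : ℝ)..a, q s * Real.cos (2 * N * s)) * Real.cos (2 * angle N Q lam x a) -
        (∫ s in (0 : ℝ)..a, q s * Real.sin (2 * N * s)) * Real.sin (2 * angle N Q lam x a)
  have h3 : κ * a - κ * J₁ + J - κ * a - G = -(κ * J₁) - (G - J) := by ring
  rw [h3]
  refine (abs_sub _ _).trans ?_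
  rw [abs_neg, abs_mul]
  have h4 := mul_le_mul_of_nonneg_left e2 (abs_nonneg κ)
  linarith

/-- Every final angle is reached. -/
theorem exists_angle_eq (lam Φ : ℝ) : ∃ x, angle N Q lam x a = Φ := by
  have hlt : ∀ x, |rotation N Q a lam x - rotation N Q a lam 0| < Real.pi :=
    fun x => h.abs_rotation_sub_lt lam x 0
  set r := rotation N Q a lam 0
  have hc : Continuous fun x => angle N Q lam x a :=
    (continuous_angle_param h.scale_pos h.continuous h.bound h.period_pos.le).comp
      (by fun_prop : Continuous fun x : ℝ => (lam, x))
  have h1 := hlt (Φ - r - Real.pi)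
  have h2 := hlt (Φ - r + Real.pi)
  rw [abs_lt, rotation] at h1 h2
  obtain ⟨x, -, hx⟩ := intermediate_value_Icc
    (by linarith [Real.pi_pos] : Φ - r - Real.pi ≤ Φ - r + Real.pi) hc.continuousOn
    (⟨by linarith [h1.2], by linarith [h2.1]⟩ : Φ ∈ Set.Icc _ _)
  exact ⟨x, hx⟩

/-- The edges of the `n`-th instability interval for `N = n π / a` large. Here `W` is `a |c_n|`,
and `M` bounds the partial Fourier integrals. The extremal rotations pass through `n π` for
`|lam - N²| ≤ K`; the error of `abs_rotation_sub_le` is `O(M / N)` only once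
`|lam - N²| = O(M)` is known, which is bootstrapped from the cruder error `O((M + N⁻¹) / N)`. -/
theorem exists_edges {n : ℕ} (hNa : N * a = n * Real.pi) {M W I K V : ℝ} (hM : 0 ≤ M)
    (hG : ∀ t ∈ Set.Icc 0 a, (∫ s in (0 : ℝ)..t, q s * Real.cos (2 * N * s)) ^ 2 +
      (∫ s in (0 : ℝ)..t, q s * Real.sin (2 * N * s)) ^ 2 ≤ M ^ 2)
    (hW : 0 ≤ W) (hWM : W ≤ M) (hMI : M ≤ I) (hWeq :
      (∫ s in (0 : ℝ)..a, q s * Real.cos (2 * N * s)) ^ 2 +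
      (∫ s in (0 : ℝ)..a, q s * Real.sin (2 * N * s)) ^ 2 = W ^ 2)
    (hI : I = ∫ t in (0 : ℝ)..a, |q t|) (hK : K * a = 2 * I + a) (hV : V = K * a + I)
    (hN1 : 1 ≤ N) (hN2 : 2 * (I + K) * V ≤ a * N) (hN3 : 2 * V ≤ N) (hN4 : 4 * V ≤ a * N) :
    ∃ lam₁ lam₂, maxRotation N Q a lam₁ = n * Real.pi ∧ minRotation N Q a lam₂ = n * Real.pi ∧
      |(lam₂ - lam₁) * a - 2 * W| ≤ 4 * V * (1 + 4 / a) * (M / N) := by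
  have ha := h.period_pos
  have hN := h.scale_pos
  have hI0 : 0 ≤ I := hM.trans hMI
  have hK0 : 0 < K := by
    by_contra! hle
    nlinarith
  have hV0 : 0 ≤ V := by rw [hV]; positivity
  have hNi : 0 < N⁻¹ := inv_pos.2 hN
  have hNi1 : N⁻¹ ≤ 1 := inv_le_one_of_one_le₀ hN1
  have hNN : N * N⁻¹ = 1 := mul_inv_cancel₀ hN.ne'
  obtain ⟨β, hβ⟩ := exists_amplitude hW hWeq
  -- the rotation up to the error `E`
  set E : ℝ → ℝ := fun κ => 2 * (M + |κ| * N⁻¹) * (N⁻¹ * V) with hE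
  have hmain : ∀ lam x, |lam - N ^ 2| ≤ K →
      |2 * N * (rotation N Q a lam x - n * Real.pi) - (lam - N ^ 2) * a -
        W * Real.cos (2 * angle N Q lam x a + β)| ≤ E (lam - N ^ 2) := by
    intro lam x hlam
    have h1 := h.abs_rotation_sub_le hNa hM hG lam x
    rw [hβ, ← hI] at h1
    refine h1.trans ?_
    simp only [hE]
    have h2 : |lam - N ^ 2| * a + I ≤ V := by rw [hV]; gcongr
    gcongr
  have hEa : ∀ κ, |κ| ≤ K → E κ ≤ a := by
    intro κ hκ
    have h1 : M + |κ| * N⁻¹ ≤ I + K := by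
      have := mul_le_mul hκ hNi1 hNi.le hK0.le
      linarith
    calc E κ = 2 * (M + |κ| * N⁻¹) * V * N⁻¹ := by rw [hE]; ring
      _ ≤ 2 * (I + K) * V * N⁻¹ := by gcongr
      _ ≤ a * N * N⁻¹ := by gcongr
      _ = a := by rw [mul_assoc, hNN, mul_one]
  have hp := h.isRotationPair
  have hlow : maxRotation N Q a (N ^ 2 - K) ≤ n * Real.pi := by
    obtain ⟨x, hx, -⟩ := h.exists_maxRotation (N ^ 2 - K)
    have habs : |N ^ 2 - K - N ^ 2| = K := by rw [sub_sub_cancel_left, abs_neg, abs_of_pos hK0]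
    have h1 := (abs_le.1 (hmain (N ^ 2 - K) x habs.le)).2
    have h2 := hEa (N ^ 2 - K - N ^ 2) habs.le
    have h3 : W * Real.cos (2 * angle N Q (N ^ 2 - K) x a + β) ≤ W :=
      mul_le_of_le_one_right hW (Real.cos_le_one _)
    rw [hx]
    by_contra! hlt
    have : 0 < 2 * N * (rotation N Q a (N ^ 2 - K) x - n * Real.pi) :=
      mul_pos (by positivity) (by linarith)
    nlinarith
  have hhigh : n * Real.pi ≤ minRotation N Q a (N ^ 2 + K) := by
    obtain ⟨x, hx, -⟩ := h.exists_minRotation (N ^ 2 + K)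
    have habs : |N ^ 2 + K - N ^ 2| = K := by rw [add_sub_cancel_left, abs_of_pos hK0]
    have h1 := (abs_le.1 (hmain (N ^ 2 + K) x habs.le)).1
    have h2 := hEa (N ^ 2 + K - N ^ 2) habs.le
    have h3 : -W ≤ W * Real.cos (2 * angle N Q (N ^ 2 + K) x a + β) := by
      nlinarith [Real.neg_one_le_cos (2 * angle N Q (N ^ 2 + K) x a + β)]
    rw [hx]
    by_contra! hlt
    have : 2 * N * (rotation N Q a (N ^ 2 + K) x - n * Real.pi) < 0 :=
      mul_neg_of_pos_of_neg (by positivity) (by linarith)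
    nlinarith
  have hle : N ^ 2 - K ≤ N ^ 2 + K := by linarith
  obtain ⟨l₁, hl₁, hU⟩ := intermediate_value_Icc hle hp.continuous_max.continuousOn
    (⟨hlow, hhigh.trans (hp.min_le_max _)⟩ : n * Real.pi ∈ Set.Icc _ _)
  obtain ⟨l₂, hl₂, hL⟩ := intermediate_value_Icc hle hp.continuous_min.continuousOn
    (⟨(hp.min_le_max _).trans hlow, hhigh⟩ : n * Real.pi ∈ Set.Icc _ _)
  have habs₁ : |l₁ - N ^ 2| ≤ K := abs_le.2 ⟨by linarith [hl₁.1], by linarith [hl₁.2]⟩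
  have habs₂ : |l₂ - N ^ 2| ≤ K := abs_le.2 ⟨by linarith [hl₂.1], by linarith [hl₂.2]⟩
  -- the exact location of the edges up to `E`
  have hedge₁ : |(l₁ - N ^ 2) * a + W| ≤ E (l₁ - N ^ 2) := by
    obtain ⟨x, hx, hxm⟩ := h.exists_maxRotation l₁
    rw [hU] at hx
    rw [abs_le]
    constructor
    · have h1 := (abs_le.1 (hmain l₁ x habs₁)).2
      rw [← hx, sub_self, mul_zero] at h1
      have h3 : W * Real.cos (2 * angle N Q l₁ x a + β) ≤ W :=
        mul_le_of_le_one_right hW (Real.cos_le_one _)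
      linarith [(abs_le.1 (hmain l₁ x habs₁)).1]
    -- at the initial angle for which the cosine is `1` the rotation is at most the largest one
    · obtain ⟨y, hy⟩ := h.exists_angle_eq l₁ (-β / 2)
      have h1 := (abs_le.1 (hmain l₁ y habs₁)).1
      have h2 : 2 * N * (rotation N Q a l₁ y - n * Real.pi) ≤ 0 :=
        mul_nonpos_of_nonneg_of_nonpos (by positivity) (by linarith [hxm y])
      rw [hy, show 2 * (-β / 2) + β = 0 by ring, Real.cos_zero, mul_one] at h1
      linarith
  have hedge₂ : |(l₂ - N ^ 2) * a - W| ≤ E (l₂ - N ^ 2) := by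
    obtain ⟨x, hx, hxm⟩ := h.exists_minRotation l₂
    rw [hL] at hx
    rw [abs_le]
    constructor
    · obtain ⟨y, hy⟩ := h.exists_angle_eq l₂ ((Real.pi - β) / 2)
      have h1 := (abs_le.1 (hmain l₂ y habs₂)).2
      have h2 : 0 ≤ 2 * N * (rotation N Q a l₂ y - n * Real.pi) :=
        mul_nonneg (by positivity) (by linarith [hxm y])
      rw [hy, show 2 * ((Real.pi - β) / 2) + β = Real.pi by ring, Real.cos_pi] at h1
      linarith
    · have h1 := (abs_le.1 (hmain l₂ x habs₂)).1
      rw [← hx, sub_self, mul_zero] at h1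
      have h3 : -W ≤ W * Real.cos (2 * angle N Q l₂ x a + β) := by
        nlinarith [Real.neg_one_le_cos (2 * angle N Q l₂ x a + β)]
      linarith [(abs_le.1 (hmain l₂ x habs₂)).2]
  -- bootstrapping: an edge is `O(M)`, hence the error is `O(M / N)`
  have hboot : ∀ κ, |κ| * a ≤ W + E κ → E κ ≤ 2 * V * (1 + 4 / a) * (M / N) := by
    intro κ hκ
    have h1 : E κ = 2 * V * N⁻¹ * M + 2 * V * N⁻¹ * N⁻¹ * |κ| := by rw [hE]; ring
    have h2 : 2 * V * N⁻¹ ≤ 1 := by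
      calc 2 * V * N⁻¹ ≤ N * N⁻¹ := by gcongr
        _ = 1 := hNN
    have h3 : 2 * V * N⁻¹ * N⁻¹ ≤ a / 2 := by
      calc 2 * V * N⁻¹ * N⁻¹ ≤ 2 * V * N⁻¹ * 1 := by gcongr
        _ = (4 * V) * N⁻¹ / 2 := by ring
        _ ≤ (a * N) * N⁻¹ / 2 := by gcongr
        _ = a / 2 := by rw [mul_assoc, hNN, mul_one]
    have h4 := mul_le_mul_of_nonneg_right h2 hM
    have h5 := mul_le_mul_of_nonneg_right h3 (abs_nonneg κ)
    have h6 : |κ| ≤ 4 * M / a := by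
      rw [le_div_iff₀ ha]
      linarith
    calc E κ = 2 * V * N⁻¹ * M + 2 * V * N⁻¹ * N⁻¹ * |κ| := h1
      _ ≤ 2 * V * N⁻¹ * M + 2 * V * N⁻¹ * 1 * (4 * M / a) := by gcongr
      _ = 2 * V * (1 + 4 / a) * (M / N) := by rw [div_eq_mul_inv M N]; ring
  have hb₁ := hboot (l₁ - N ^ 2) (by
    rw [← abs_of_pos ha, ← abs_mul]
    have := abs_sub ((l₁ - N ^ 2) * a + W) W
    rw [add_sub_cancel_right, abs_of_nonneg hW] at this
    linarith)
  have hb₂ := hboot (l₂ - N ^ 2) (by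
    rw [← abs_of_pos ha, ← abs_mul]
    have := abs_add_le ((l₂ - N ^ 2) * a - W) W
    rw [sub_add_cancel, abs_of_nonneg hW] at this
    linarith)
  refine ⟨l₁, l₂, hU, hL, ?_⟩
  have : (l₂ - l₁) * a - 2 * W = ((l₂ - N ^ 2) * a - W) - ((l₁ - N ^ 2) * a + W) := by ring
  rw [this]
  refine (abs_sub _ _).trans ?_
  linarith

end IsHillData

/-! ### Width of the instability intervals -/

theorem twist_eq {a : ℝ} (q : ℝ → ℝ) (n : ℕ) (x : ℝ) :
    twist a q n x = ((q x * Real.cos (2 * (n * Real.pi / a) * x) : ℝ) : ℂ) -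
      ((q x * Real.sin (2 * (n * Real.pi / a) * x) : ℝ) : ℂ) * Complex.I := by
  have h1 : -(Complex.I * ((2 * n * Real.pi * x / a : ℝ) : ℂ)) =
      ((-(2 * (n * Real.pi / a) * x) : ℝ) : ℂ) * Complex.I := by
    push_cast
    ring
  rw [twist, h1, Complex.exp_mul_I, ← Complex.ofReal_cos, ← Complex.ofReal_sin, Real.cos_neg,
    Real.sin_neg]
  push_cast
  ring

theorem integral_twist {a : ℝ} {q : ℝ → ℝ} (hq : ∀ s t, IntervalIntegrable q volume s t) (n : ℕ)
    (t : ℝ) : ∫ x in (0 : ℝ)..t, twist a q n x =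
      ((∫ x in (0 : ℝ)..t, q x * Real.cos (2 * (n * Real.pi / a) * x) : ℝ) : ℂ) -
      ((∫ x in (0 : ℝ)..t, q x * Real.sin (2 * (n * Real.pi / a) * x) : ℝ) : ℂ) * Complex.I := by
  have h1 : IntervalIntegrable (fun x => q x * Real.cos (2 * (n * Real.pi / a) * x)) volume 0 t :=
    (hq 0 t).mul_continuousOn (by fun_prop)
  have h2 : IntervalIntegrable (fun x => q x * Real.sin (2 * (n * Real.pi / a) * x)) volume 0 t :=
    (hq 0 t).mul_continuousOn (by fun_prop)
  have h3 : IntervalIntegrable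
      (fun x => ((q x * Real.cos (2 * (n * Real.pi / a) * x) : ℝ) : ℂ)) volume 0 t :=
    ⟨h1.1.ofReal, h1.2.ofReal⟩
  have h4 : IntervalIntegrable
      (fun x => ((q x * Real.sin (2 * (n * Real.pi / a) * x) : ℝ) : ℂ)) volume 0 t :=
    ⟨h2.1.ofReal, h2.2.ofReal⟩
  simp only [twist_eq]
  rw [intervalIntegral.integral_sub h3 (h4.mul_const _),
    intervalIntegral.integral_mul_const, intervalIntegral.integral_ofReal,
    intervalIntegral.integral_ofReal]

theorem sq_norm_integral_twist {a : ℝ} {q : ℝ → ℝ}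
    (hq : ∀ s t, IntervalIntegrable q volume s t) (n : ℕ) (t : ℝ) :
    (∫ x in (0 : ℝ)..t, q x * Real.cos (2 * (n * Real.pi / a) * x)) ^ 2 +
      (∫ x in (0 : ℝ)..t, q x * Real.sin (2 * (n * Real.pi / a) * x)) ^ 2 =
      ‖∫ x in (0 : ℝ)..t, twist a q n x‖ ^ 2 := by
  rw [integral_twist hq, ← Complex.normSq_eq_norm_sq, sub_eq_add_neg, ← neg_mul,
    ← Complex.ofReal_neg, Complex.normSq_add_mul_I]
  ring

theorem norm_twist (a : ℝ) (q : ℝ → ℝ) (n : ℕ) (x : ℝ) : ‖twist a q n x‖ = |q x| := by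
  have h1 : -(Complex.I * ((2 * n * Real.pi * x / a : ℝ) : ℂ)) =
      ((-(2 * n * Real.pi * x / a) : ℝ) : ℂ) * Complex.I := by
    push_cast
    ring
  rw [twist, h1, norm_mul, Complex.norm_exp_ofReal_mul_I, mul_one, Complex.norm_real,
    Real.norm_eq_abs]

theorem norm_integral_twist_le {a : ℝ} {q : ℝ → ℝ}
    (hq : ∀ s t, IntervalIntegrable q volume s t) (n : ℕ) {t : ℝ} (ht : t ∈ Set.Icc 0 a) :
    ‖∫ x in (0 : ℝ)..t, twist a q n x‖ ≤ ∫ x in (0 : ℝ)..a, |q x| := by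
  refine (intervalIntegral.norm_integral_le_integral_norm ht.1).trans ?_
  simp only [norm_twist]
  exact intervalIntegral.integral_mono_interval le_rfl ht.1 ht.2
    (Eventually.of_forall fun x => abs_nonneg _) (hq 0 a).abs

theorem norm_integral_twist_le_rho {a : ℝ} {q : ℝ → ℝ}
    (hq : ∀ s t, IntervalIntegrable q volume s t) (n : ℕ) {t : ℝ} (ht : t ∈ Set.Icc 0 a) :
    ‖∫ x in (0 : ℝ)..t, twist a q n x‖ ≤ rho a q n := by
  have hb : BddAbove
      (Set.range fun x : Set.Icc (0 : ℝ) a => ‖∫ t in (0 : ℝ)..x, twist a q n t‖) := by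
    refine ⟨∫ x in (0 : ℝ)..a, |q x|, ?_⟩
    rintro _ ⟨x, rfl⟩
    exact norm_integral_twist_le hq n x.2
  exact le_ciSup hb ⟨t, ht⟩

theorem rho_nonneg (a : ℝ) (q : ℝ → ℝ) (n : ℕ) : 0 ≤ rho a q n :=
  Real.iSup_nonneg fun _ => norm_nonneg _

theorem rho_le {a : ℝ} (ha : 0 < a) {q : ℝ → ℝ} (hq : ∀ s t, IntervalIntegrable q volume s t)
    (n : ℕ) : rho a q n ≤ ∫ x in (0 : ℝ)..a, |q x| := by
  have : Nonempty (Set.Icc (0 : ℝ) a) := ⟨⟨0, le_rfl, ha.le⟩⟩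
  exact ciSup_le fun x => norm_integral_twist_le hq n x.2

theorem norm_integral_twist_period {a : ℝ} (ha : 0 < a) (q : ℝ → ℝ) (n : ℕ) :
    ‖∫ x in (0 : ℝ)..a, twist a q n x‖ = a * ‖coeff a q n‖ := by
  rw [coeff, norm_mul, norm_div, norm_one, Complex.norm_real, Real.norm_of_nonneg ha.le]
  field_simp

/-- The width of the `n`-th instability interval is `2 |c_n|` up to `O(ρ_n / n)`. -/
theorem exists_width_bound {a : ℝ} (ha : 0 < a) {q : ℝ → ℝ} (hper : Function.Periodic q a)
    (hq : IntervalIntegrable q volume 0 a) (hc0 : coeff a q 0 = 0) :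
    ∃ C : ℝ, 0 ≤ C ∧ ∃ n₀ : ℕ, ∀ n ≥ n₀,
      |eigenvalue a q ((-1) ^ n) n - eigenvalue a q ((-1) ^ n) (n - 1) - 2 * ‖coeff a q n‖| ≤
        C * (rho a q n / n) := by
  have hqi : ∀ s t, IntervalIntegrable q volume s t := hper.intervalIntegrable₀ ha.ne' hq
  set Q : ℝ → ℝ := fun x => ∫ t in (0 : ℝ)..x, q t with hQ
  have hprim : IsPrimitive q Q := isPrimitive_integral hqi
  have hQa : Q a = 0 := by
    have h1 := norm_integral_twist_period ha q 0
    rw [hc0, norm_zero, mul_zero, norm_eq_zero, integral_twist hqi] at h1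
    have h2 := congrArg Complex.re h1
    simpa using h2
  obtain ⟨B, hB⟩ : ∃ B, ∀ t, |Q t| ≤ B := by
    obtain ⟨B, hB⟩ := (isCompact_Icc (a := (0 : ℝ)) (b := a)).exists_bound_of_continuousOn
      hprim.continuous.continuousOn
    have hQper : Function.Periodic Q a := by
      intro x
      have h1 := intervalIntegral.integral_add_adjacent_intervals (hqi 0 x) (hqi x (x + a))
      have h2 := hper.intervalIntegral_add_eq x 0
      rw [zero_add] at h2
      change ∫ t in (0 : ℝ)..a, q t = 0 at hQa
      simp only [hQ]
      rw [← h1, h2, hQa, add_zero]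
    refine ⟨B, fun t => ?_⟩
    obtain ⟨y, hy, hty⟩ := hQper.exists_mem_Ico₀ ha t
    rw [hty]
    exact hB y (Set.Ico_subset_Icc_self hy)
  set I : ℝ := ∫ t in (0 : ℝ)..a, |q t| with hI
  have hI0 : 0 ≤ I := intervalIntegral.integral_nonneg ha.le fun _ _ => abs_nonneg _
  -- the edges lie within `K` of `N²`, and `V / N` bounds the integral of the deviation of the
  -- derivative of the Prüfer angle from `N`; for `N ≥ T` all hypotheses of `exists_edges` hold
  set K : ℝ := 2 * I / a + 1 with hK
  have hKa : K * a = 2 * I + a := by rw [hK]; field_simp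
  have hK0 : 0 ≤ K := by positivity
  set V : ℝ := K * a + I with hV
  have hV0 : 0 ≤ V := by positivity
  have hpi := Real.pi_pos
  set T : ℝ := 1 + 2 * (I + K) * V / a + 2 * V + 4 * V / a with hT
  have hT1 : 0 ≤ 2 * (I + K) * V / a := by positivity
  have hT2 : 0 ≤ 4 * V / a := by positivity
  refine ⟨4 * V * (1 + 4 / a) / Real.pi, by positivity, ⌈T * a / Real.pi⌉₊ + 1, fun n hn => ?_⟩
  have hn1 : 1 ≤ n := by omega
  have hn0 : (0 : ℝ) < n := by exact_mod_cast hn1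
  set N : ℝ := n * Real.pi / a with hN
  have hNa : N * a = n * Real.pi := by rw [hN]; field_simp
  have hNpos : 0 < N := by positivity
  have hTN : T ≤ N := by
    have h1 : T * a / Real.pi ≤ n :=
      (Nat.le_ceil _).trans (by exact_mod_cast (by omega : ⌈T * a / Real.pi⌉₊ ≤ n))
    rw [hN, le_div_iff₀ ha]
    exact (div_le_iff₀ hpi).1 h1
  have hdata : IsHillData a N B q Q := ⟨ha, hNpos, hprim, hB, hQa⟩
  have hendp : a ∈ Set.Icc 0 a := ⟨ha.le, le_rfl⟩
  obtain ⟨l₁, l₂, hU, hL, hw⟩ := hdata.exists_edges hNa (M := rho a q n)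
    (W := ‖∫ x in (0 : ℝ)..a, twist a q n x‖) (I := I) (K := K) (V := V) (rho_nonneg a q n)
    (fun t ht => by
      rw [sq_norm_integral_twist hqi]
      exact pow_le_pow_left₀ (norm_nonneg _) (norm_integral_twist_le_rho hqi n ht) 2)
    (norm_nonneg _) (norm_integral_twist_le_rho hqi n hendp) (rho_le ha hqi n)
    (sq_norm_integral_twist hqi n a) hI hKa hV
    (by linarith)
    (by
      have : 2 * (I + K) * V / a ≤ N := by linarith
      rw [div_le_iff₀ ha] at this
      linarith)
    (by linarith)
    (by
      have : 4 * V / a ≤ N := by linarith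
      rw [div_le_iff₀ ha] at this
      linarith)
  rw [hdata.eigenvalue_eq_of_maxRotation hn1 hU, hdata.eigenvalue_eq_of_minRotation hn1 hL]
  rw [norm_integral_twist_period ha] at hw
  have h1 : (l₂ - l₁) * a - 2 * (a * ‖coeff a q n‖) = (l₂ - l₁ - 2 * ‖coeff a q n‖) * a := by ring
  rw [h1, abs_mul, abs_of_pos ha] at hw
  refine le_of_mul_le_mul_right (hw.trans_eq ?_) ha
  rw [hN]
  field_simp

/-- From an absolute to a relative error. -/
theorem exists_relative_error {ℓ : ℕ → ℝ} {c : ℕ → ℂ} {g : ℕ → ℝ}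
    (hc : ∀ᶠ m in atTop, c m ≠ 0) (h : ∀ᶠ m in atTop, |ℓ m - 2 * ‖c m‖| ≤ 2 * ‖c m‖ * g m) :
    ∃ δ : ℕ → ℝ, (∀ᶠ m in atTop, |δ m| ≤ g m) ∧
      ∀ᶠ m in atTop, ℓ m = 2 * ‖c m‖ * (1 + δ m) := by
  refine ⟨fun m => (ℓ m - 2 * ‖c m‖) / (2 * ‖c m‖), ?_, ?_⟩
  · filter_upwards [hc, h] with m hm hle
    have hpos : 0 < 2 * ‖c m‖ := mul_pos two_pos (norm_pos_iff.2 hm)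
    rw [abs_div, abs_of_pos hpos, div_le_iff₀ hpos]
    linarith
  · filter_upwards [hc] with m hm
    have hpos : 0 < ‖c m‖ := norm_pos_iff.2 hm
    field_simp
    ring

/-- The three asymptotic statements follow from the bound `O(ρ / m)` for the absolute error. -/
theorem width_asymptotics {ℓ : ℕ → ℝ} {c : ℕ → ℂ} {r : ℕ → ℝ} (hr : ∀ m, 0 ≤ r m) {C : ℝ}
    (hC : 0 ≤ C) (h : ∀ᶠ m : ℕ in atTop, |ℓ m - 2 * ‖c m‖| ≤ C * (r m / m)) :
    (LimCondition c r → ∃ δ : ℕ → ℝ, δ =o[atTop] (fun _ => (1 : ℝ)) ∧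
      ∀ᶠ m : ℕ in atTop, ℓ m = 2 * ‖c m‖ * (1 + δ m)) ∧
    (SimCondition c r → ∃ δ : ℕ → ℝ, δ =O[atTop] (fun m => 1 / (m : ℝ)) ∧
      ∀ᶠ m : ℕ in atTop, ℓ m = 2 * ‖c m‖ * (1 + δ m)) ∧
    (LowerCondition c → ∃ δ : ℕ → ℝ, δ =O[atTop] r ∧
      ∀ᶠ m : ℕ in atTop, ℓ m = 2 * ‖c m‖ * (1 + δ m)) := by
  refine ⟨?_, ?_, ?_⟩
  · rintro ⟨hc, hlim⟩
    obtain ⟨δ, hδ, hℓ⟩ := exists_relative_error (ℓ := ℓ)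
      (g := fun m => C / 2 * ‖(r m : ℂ) / ((m : ℂ) * c m)‖) hc (by
        filter_upwards [h, hc] with m hm hcm
        refine hm.trans_eq ?_
        have hpos : ‖c m‖ ≠ 0 := norm_ne_zero_iff.2 hcm
        rw [norm_div, norm_mul, Complex.norm_real, Complex.norm_natCast,
          Real.norm_of_nonneg (hr m)]
        field_simp)
    refine ⟨δ, (Asymptotics.isLittleO_one_iff ℝ).2 ?_, hℓ⟩
    refine squeeze_zero_norm' hδ ?_
    simpa using (hlim.norm.const_mul (C / 2))
  · rintro ⟨C₁, C₂, hC₁, -, hsim⟩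
    have hc : ∀ᶠ m in atTop, c m ≠ 0 := by
      filter_upwards [hsim] with m hm hcm
      rw [hcm, zero_div, norm_zero] at hm
      linarith [hm.1]
    obtain ⟨δ, hδ, hℓ⟩ := exists_relative_error (ℓ := ℓ)
      (g := fun m => C / (2 * C₁) * (1 / m)) hc (by
        filter_upwards [h, hsim] with m hm hs
        refine hm.trans ?_
        have h1 := hs.1
        rw [norm_div, Complex.norm_real, Real.norm_of_nonneg (hr m)] at h1
        have hr0 : r m ≠ 0 := by
          intro h0
          rw [h0, div_zero] at h1
          linarith
        have hrpos : 0 < r m := lt_of_le_of_ne (hr m) hr0.symm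
        have h2 : C₁ * r m ≤ ‖c m‖ := ((lt_div_iff₀ hrpos).1 h1).le
        have h3 : r m ≤ ‖c m‖ / C₁ := by rw [le_div_iff₀ hC₁]; linarith
        calc C * (r m / m) ≤ C * (‖c m‖ / C₁ / m) := by gcongr
          _ = 2 * ‖c m‖ * (C / (2 * C₁) * (1 / m)) := by field_simp)
    refine ⟨δ, Asymptotics.IsBigO.of_bound (C / (2 * C₁)) ?_, hℓ⟩
    filter_upwards [hδ] with m hm
    rwa [Real.norm_eq_abs, Real.norm_of_nonneg (by positivity)]
  · rintro ⟨ε, hε, hlow⟩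
    have hc : ∀ᶠ m in atTop, c m ≠ 0 := by
      filter_upwards [hlow] with m hm hcm
      rw [hcm, norm_zero] at hm
      exact absurd hm (not_lt.2 (by positivity))
    obtain ⟨δ, hδ, hℓ⟩ := exists_relative_error (ℓ := ℓ)
      (g := fun m => C / (2 * ε) * r m) hc (by
        filter_upwards [h, hlow] with m hm hs
        refine hm.trans ?_
        have h1 := mul_le_mul_of_nonneg_left hs.le
          (by have := hr m; positivity : 0 ≤ C * r m / ε)
        calc C * (r m / m) = C * r m / ε * (ε / m) := by field_simp
          _ ≤ C * r m / ε * ‖c m‖ := h1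
          _ = 2 * ‖c m‖ * (C / (2 * ε) * r m) := by field_simp)
    refine ⟨δ, Asymptotics.IsBigO.of_bound (C / (2 * ε)) ?_, hℓ⟩
    filter_upwards [hδ] with m hm
    rwa [Real.norm_eq_abs, Real.norm_of_nonneg (hr m)]

end Hill

end

theorem mainTheorem2 (a : ℝ) (ha : 0 < a) (q : ℝ → ℝ) (hper : Function.Periodic q a)
    (hq : IntervalIntegrable q volume 0 a) (hc0 : Hill.coeff a q 0 = 0) :
    -- the periodic case
    ((Hill.LimCondition (fun m => Hill.coeff a q (2 * m + 2))
          (fun m => Hill.rho a q (2 * m + 2)) →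
        ∃ δ : ℕ → ℝ, δ =o[atTop] (fun _ => (1 : ℝ)) ∧ ∀ᶠ m : ℕ in atTop,
          Hill.evenWidth a q m = 2 * ‖Hill.coeff a q (2 * m + 2)‖ * (1 + δ m)) ∧
      (Hill.SimCondition (fun m => Hill.coeff a q (2 * m + 2))
          (fun m => Hill.rho a q (2 * m + 2)) →
        ∃ δ : ℕ → ℝ, δ =O[atTop] (fun m => 1 / (m : ℝ)) ∧ ∀ᶠ m : ℕ in atTop,
          Hill.evenWidth a q m = 2 * ‖Hill.coeff a q (2 * m + 2)‖ * (1 + δ m)) ∧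
      (Hill.LowerCondition (fun m => Hill.coeff a q (2 * m + 2)) →
        ∃ δ : ℕ → ℝ, δ =O[atTop] (fun m => Hill.rho a q (2 * m + 2)) ∧ ∀ᶠ m : ℕ in atTop,
          Hill.evenWidth a q m = 2 * ‖Hill.coeff a q (2 * m + 2)‖ * (1 + δ m))) ∧
    -- the antiperiodic case
    ((Hill.LimCondition (fun m => Hill.coeff a q (2 * m + 1))
          (fun m => Hill.rho a q (2 * m + 1)) →
        ∃ δ : ℕ → ℝ, δ =o[atTop] (fun _ => (1 : ℝ)) ∧ ∀ᶠ m : ℕ in atTop,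
          Hill.oddWidth a q m = 2 * ‖Hill.coeff a q (2 * m + 1)‖ * (1 + δ m)) ∧
      (Hill.SimCondition (fun m => Hill.coeff a q (2 * m + 1))
          (fun m => Hill.rho a q (2 * m + 1)) →
        ∃ δ : ℕ → ℝ, δ =O[atTop] (fun m => 1 / (m : ℝ)) ∧ ∀ᶠ m : ℕ in atTop,
          Hill.oddWidth a q m = 2 * ‖Hill.coeff a q (2 * m + 1)‖ * (1 + δ m)) ∧
      (Hill.LowerCondition (fun m => Hill.coeff a q (2 * m + 1)) →
        ∃ δ : ℕ → ℝ, δ =O[atTop] (fun m => Hill.rho a q (2 * m + 1)) ∧ ∀ᶠ m : ℕ in atTop,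
          Hill.oddWidth a q m = 2 * ‖Hill.coeff a q (2 * m + 1)‖ * (1 + δ m))) := by
  obtain ⟨C, hC, n₀, hbound⟩ := Hill.exists_width_bound ha hper hq hc0
  -- both families of widths have the form of the general bound, with index `n ≥ m`
  have hweak : ∀ (n m : ℕ), m ≤ n → 1 ≤ m →
      C * (Hill.rho a q n / n) ≤ C * (Hill.rho a q n / m) := by
    intro n m hmn hm
    have h1 : (0 : ℝ) < m := by exact_mod_cast hm
    have h2 : (m : ℝ) ≤ n := by exact_mod_cast hmn
    have := Hill.rho_nonneg a q n
    gcongr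
  constructor
  · refine Hill.width_asymptotics (C := C) (fun m => Hill.rho_nonneg a q _) hC ?_
    filter_upwards [eventually_ge_atTop (n₀ + 1)] with m hm
    have h1 := hbound (2 * m + 2) (by omega)
    rw [(by ring : 2 * m + 2 = 2 * (m + 1)), pow_mul, neg_one_sq, one_pow,
      (by ring : 2 * (m + 1) = 2 * m + 2)] at h1
    exact h1.trans (hweak _ _ (by omega) (by omega))
  · refine Hill.width_asymptotics (C := C) (fun m => Hill.rho_nonneg a q _) hC ?_
    filter_upwards [eventually_ge_atTop (n₀ + 1)] with m hm
    have h1 := hbound (2 * m + 1) (by omega)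
    rw [pow_succ, pow_mul, neg_one_sq, one_pow, one_mul] at h1
    exact h1.trans (hweak _ _ (by omega) (by omega))
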